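/- Let $\Omega\subset\mathbb C$ be a bounded simply connected domain whose boundary is a smooth ($C^\infty$) simple closed curve, oriented counterclockwise, with outer unit normal $n(z)$ at $z\in\partial\Omega$. For $v\in\partial\Omega$ let $f_\Omega^v$ denote the solution of the following boundary value problem: $f_\Omega^v$ is holomorphic in $\Omega$ and continuous on $\overline\Omega\smallsetminus\{v\}$, $$f_\Omega^v(z)=\frac1{2\pi}\cdot\frac{i\sqrt{n(v)}}{z-v}+O(1)\quad\text{as } z\to v,\qquad \operatorname{Im}\bigl[f_\Omega^v(z)\sqrt{n(z)}\bigr]=0\quad\text{for } z\in\partial\Omega\smallsetminus\{v\};$$ a different choice of the root $\sqrt{n(v)}$ only changes the sign of $f_\Omega^v$, and the second condition does not depend on the choice of the root. Let $u_0\neq v_0$ be two points lying on straight parts of $\partial\Omega$ (that is, each is an interior point of a line segment contained in $\partial\Omega$). Write $(u_0v_0)$ and $(v_0u_0)$ for the open arcs of $\partial\Omega$ from $u_0$ to $v_0$ and from $v_0$ to $u_0$ in the counterclockwise direction, and assume that $0\in(u_0v_0)$. Put $f_\Omega:=f_\Omega^{v_0}$ and $g_\Omega:=f_\Omega^{u_0}$.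 Then the function $$w\longmapsto\int_0^w\operatorname{Re}\bigl[f_\Omega(z)g_\Omega(z)\,dz\bigr],\qquad w\in\Omega,$$ is well defined (every $w\in\Omega$ can be joined to $0$ by a piecewise $C^1$ path that lies in $\Omega$ except for its starting point $0$, and the integral exists along every such path and does not depend on it), and it is proportional to the harmonic measure of the arc $(v_0u_0)$: there is a real constant $c\neq0$ such that for all $w\in\Omega$ $$\int_0^w\operatorname{Re}\bigl[f_\Omega(z)g_\Omega(z)\,dz\bigr]=c\cdot\operatorname{hm}_\Omega\bigl(w,(v_0u_0)\bigr).$$ -/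

import Mathlib

open Set Filter Topology MeasureTheory
open scoped ContDiff

namespace Hedgehog

/-- `β` is a counterclockwise natural (arc-length) parametrization, of period `L`, of the boundary
of `Ω`, and this boundary is a smooth (`C^∞`) simple closed curve with `Ω` locally on one side of
it: `Ω` lies to the left of `β`, and the complement of its closure to the right. -/
structure IsSmoothBoundaryParam (Ω : Set ℂ) (β : ℝ → ℂ) (L : ℝ) : Prop where
  length_pos : 0 < L
  contDiff : ContDiff ℝ ∞ β
  periodic : Function.Periodic β L
  unit_speed : ∀ t, ‖deriv β t‖ = 1
  injOn : InjOn β (Ico 0 L)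
  range_eq : range β = frontier Ω
  left_mem : ∀ t, ∀ᶠ ε : ℝ in 𝓝[>] 0, β t + (ε : ℂ) * (Complex.I * deriv β t) ∈ Ω
  right_notMem : ∀ t, ∀ᶠ ε : ℝ in 𝓝[>] 0, β t - (ε : ℂ) * (Complex.I * deriv β t) ∉ closure Ω

/-- The outer unit normal at the boundary point `β t`, for a counterclockwise natural
parametrization `β` of the boundary. -/
noncomputable def outerNormal (β : ℝ → ℂ) (t : ℝ) : ℂ := -Complex.I * deriv β t

/-- The open boundary arc run through counterclockwise from `p` to `q`. -/
def boundaryArc (β : ℝ → ℂ) (L : ℝ) (p q : ℂ) : Set ℂ :=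
  {z | ∃ a b : ℝ, β a = p ∧ β b = q ∧ a < b ∧ b < a + L ∧ z ∈ β '' Ioo a b}

/-- `p` lies on a straight part of the boundary of `Ω`. -/
def OnStraightPart (Ω : Set ℂ) (p : ℂ) : Prop :=
  ∃ a b : ℂ, a ≠ b ∧ p ∈ openSegment ℝ a b ∧ openSegment ℝ a b ⊆ frontier Ω

/-- `f` is the solution, up to the choice of the sign of `√n(v)`, of the Riemann boundary value
problem in `Ω` with a pole at the boundary point `v`: it is holomorphic in `Ω`, continuous up to
the boundary away from `v`, equals `(1 / 2π) · i√n(v) / (z - v) + O(1)` near `v`, and satisfies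
`Im [f(z) √n(z)] = 0` at all boundary points `z ≠ v` (for both square roots, the condition being
the same). -/
structure IsBoundaryPoleSolution (Ω : Set ℂ) (β : ℝ → ℂ) (v : ℂ) (f : ℂ → ℂ) : Prop where
  differentiableOn : DifferentiableOn ℂ f Ω
  continuousOn : ContinuousOn f (closure Ω \ {v})
  pole : ∃ (t : ℝ) (σ : ℂ), β t = v ∧ σ ^ 2 = outerNormal β t ∧
    (fun z => f z - 1 / (2 * (Real.pi : ℂ)) * (Complex.I * σ / (z - v)))
      =O[𝓝[Ω] v] (fun _ => (1 : ℝ))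
  boundary : ∀ (t : ℝ) (σ : ℂ), β t ≠ v → σ ^ 2 = outerNormal β t → (f (β t) * σ).im = 0

/-- A continuous subharmonic function on an open set `Ω`. -/
def IsContSubharmonicOn (s : ℂ → ℝ) (Ω : Set ℂ) : Prop :=
  ContinuousOn s Ω ∧
    ∀ z ∈ Ω, ∀ r : ℝ, 0 < r → Metric.closedBall z r ⊆ Ω → s z ≤ Real.circleAverage s z r

/-- The harmonic measure `hm_Ω(w, A)` of a boundary set `A` seen from `w`, as the Perron solution
of the Dirichlet problem whose boundary values are the indicator of `A`: the supremum at `w` of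
the subharmonic functions `s` with `limsup_{z → ζ} s(z) ≤ 1_A(ζ)` at all boundary points `ζ`. -/
noncomputable def harmonicMeasure (Ω A : Set ℂ) (w : ℂ) : ℝ :=
  sSup {x : ℝ | ∃ s : ℂ → ℝ, IsContSubharmonicOn s Ω ∧
    (∀ ζ ∈ frontier Ω, ∀ ε : ℝ, 0 < ε → ∀ᶠ z in 𝓝[Ω] ζ, s z < A.indicator (fun _ => 1) ζ + ε) ∧
    x = s w}

/-- The real 1-form `Re [h(z) dz]`. -/
noncomputable def reForm (h : ℂ → ℂ) (z : ℂ) : ℂ →L[ℝ] ℝ :=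
  Complex.reCLM.comp (ContinuousLinearMap.mul ℝ ℂ (h z))

/-- A piecewise `C^1` path `γ` from `p` to `q` that lies in `Ω`, except possibly for its
starting point. -/
def IsPathInto (Ω : Set ℂ) {p q : ℂ} (γ : Path p q) : Prop :=
  (∀ t : unitInterval, 0 < t → γ t ∈ Ω) ∧
    ∃ (N : ℕ) (τ : ℕ → ℝ), Monotone τ ∧ τ 0 = 0 ∧ τ N = 1 ∧
      ∀ i < N, ContDiffOn ℝ 1 γ.extend (Icc (τ i) (τ (i + 1)))

end Hedgehog

/-! Along the boundary the outer normal is n = -iτ, with τ = β' the unit tangent. As f√n and g√n are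
both real, so is their product fgn = -i·fgτ, which means that Re[fg dz] vanishes along ∂Ω off u₀ and
v₀ (`IsBoundaryPoleSolution.re_mul_mul_deriv_eq_zero`). On the simply connected Ω the product fg has
a primitive F (`exists_primitive`). Its real part is harmonic and tends to a constant on each of the
two arcs: K₁ on (u₀v₀), K₂ on (v₀u₀) (`exists_eventually_tendsto_re`, `exists_tendsto_re_of_Ioo`).

At u₀ the function g has a simple pole and f is continuous, so fg has the residue iσf(u₀)/2π with σ²
= n(u₀). This is imaginary because σf(u₀) is real; v₀ is symmetric. An imaginary residue contributes
to Re F only a bounded multiple of an argument, so Re F is o(log) there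
(`eventually_abs_re_le_sub_log`). Such singularities do not affect the maximum principle: small
multiples of a logarithmic barrier absorb them (`exists_log_barrier`,
`harmonicMeasure_eq_of_barrier`). Hence Re F - K₁ is K₂ - K₁ times the harmonic measure of (v₀u₀).

If K₁ = K₂, then Re F is constant and fg = 0, so f or g vanishes identically, contrary to its pole.
Finally, the integral from 0 to w is Re F(w) minus the limit of Re F at 0
(`IsPathInto.curveIntegral_reForm`), and this limit is K₁ because 0 lies on (u₀v₀). -/

namespace Hedgehog

/-! ### Primitives on simply connected domains -/

/-- Functions that are given locally, with locally constant differences, glue up to locally constant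
functions on a simply connected space. -/
theorem exists_glue_of_eventually_sub_eq {B F : Type*} [TopologicalSpace B]
    [SimplyConnectedSpace B] [LocallyPathConnectedSpace B] [AddCommGroup F] (U : B → Set B)
    (hU : ∀ i, IsOpen (U i)) (hmem : ∀ i, i ∈ U i) (P : B → B → F)
    (hP : ∀ i j, ∀ x ∈ U i ∩ U j, ∀ᶠ y in 𝓝 x, P i y - P j y = P i x - P j x) :
    ∃ G : B → F, ∀ x, ∀ᶠ y in 𝓝 x, G y - P x y = G x - P x x := by
  -- With discrete fibre and the locally constant translations `P i - P j` as transition maps, the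
  -- local data define a covering space of `B`.
  let : TopologicalSpace F := ⊥
  have : DiscreteTopology F := ⟨rfl⟩
  let Z : FiberBundleCore B B F :=
    { baseSet := U
      isOpen_baseSet := hU
      indexAt := id
      mem_baseSet_at := hmem
      coordChange := fun i j b w => w + (P i b - P j b)
      coordChange_self := by intro i x _ v; simp
      continuousOn_coordChange := by
        intro i j p hp
        apply ContinuousAt.continuousWithinAt
        have h1 : ∀ᶠ q : B × F in 𝓝 p, q.2 + (P i q.1 - P j q.1) = p.2 + (P i p.1 - P j p.1) := by
          rw [nhds_prod_eq, nhds_discrete F]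
          have := (hP i j p.1 hp.1).prod_mk (show ∀ᶠ y in pure p.2, y = p.2 by simp)
          filter_upwards [this] with q hq
          rw [hq.1, hq.2]
        exact (continuousAt_const.congr (h1.mono fun q hq => hq.symm))
      coordChange_comp := by intro i j k x _ v; abel }
  have cov : IsCoveringMap Z.proj := by
    apply IsCoveringMap.mk _ (fun _ => F) (fun x => Z.localTriv x)
    intro x
    exact hmem x
  obtain ⟨x₀⟩ : Nonempty B := inferInstance
  -- Simple connectedness lifts the identity of `B` to a global section. In the trivialization
  -- indexed by `x` it is locally constant, and this coordinate at `y` is `σ y + P y y - P x y`,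
  -- which dictates the glued function.
  obtain ⟨s, ⟨-, hs⟩, -⟩ := cov.existsUnique_continuousMap_lifts (ContinuousMap.id B) x₀
    (⟨x₀, (0 : F)⟩ : Z.TotalSpace) rfl
  have hproj : ∀ x, (s x).proj = x := fun x => congrFun hs x
  let σ : B → F := fun x => (s x).2
  let c : B → B → F := fun i x => (Z.localTriv i (s x)).2
  have hc : ∀ i x, c i x = σ x + (P x x - P i x) := by
    intro i x
    have : c i x = σ x + (P (s x).proj (s x).proj - P i (s x).proj) := rfl
    rw [this, hproj]
  have hlc : ∀ x, ∀ᶠ y in 𝓝 x, c x y = c x x := by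
    intro x
    have h1 : ContinuousAt (fun y => (Z.localTriv x (s y)).2) x := by
      have hsrc : s x ∈ (Z.localTriv x).source := by
        rw [Bundle.Trivialization.mem_source]
        show (s x).proj ∈ U x
        rw [hproj]; exact hmem x
      have h2 := (Z.localTriv x).continuousAt hsrc
      exact continuousAt_snd.comp (h2.comp s.continuous.continuousAt)
    have h3 := h1.eventually (show ∀ᶠ w in 𝓝 (Z.localTriv x (s x)).2,
      w = (Z.localTriv x (s x)).2 by rw [nhds_discrete]; simp)
    exact h3
  refine ⟨fun x => σ x + P x x, fun x => ?_⟩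
  filter_upwards [hlc x] with y hy
  rw [hc, hc] at hy
  have : σ y + P y y - P x y = σ y + (P y y - P x y) := by abel
  rw [this, hy]; abel

/-- Holomorphic functions on simply connected domains have primitives. -/
theorem exists_primitive {Ω : Set ℂ} (hopen : IsOpen Ω) (hsc : IsSimplyConnected Ω) {h : ℂ → ℂ}
    (hh : DifferentiableOn ℂ h Ω) : ∃ F : ℂ → ℂ, ∀ z ∈ Ω, HasDerivAt F (h z) z := by
  classical
  have := hsc.simplyConnectedSpace
  have := hopen.locallyPathConnectedSpace
  have hr : ∀ i : Ω, ∃ r > 0, Metric.ball (i : ℂ) r ⊆ Ω := fun i => Metric.isOpen_iff.1 hopen i i.2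
  choose r hr0 hrΩ using hr
  have hprim : ∀ i : Ω, ∃ P : ℂ → ℂ, ∀ z ∈ Metric.ball (i : ℂ) (r i), HasDerivAt P (h z) z :=
    fun i => (hh.mono (hrΩ i)).isExactOn_ball
  choose P hP using hprim
  obtain ⟨G, hG⟩ := exists_glue_of_eventually_sub_eq
    (fun i : Ω => {x : Ω | (x : ℂ) ∈ Metric.ball (i : ℂ) (r i)})
    (fun i => Metric.isOpen_ball.preimage continuous_subtype_val)
    (fun i => Metric.mem_ball_self (hr0 i)) (fun i x => P i x) (by
      intro i j x hx
      have hopen' : IsOpen (Metric.ball (i : ℂ) (r i) ∩ Metric.ball (j : ℂ) (r j)) :=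
        Metric.isOpen_ball.inter Metric.isOpen_ball
      obtain ⟨ρ, hρ, hsub⟩ := Metric.isOpen_iff.1 hopen' x hx
      have hconst : ∀ y ∈ Metric.ball (x : ℂ) ρ, P i y - P j y = P i x - P j x := by
        intro y hy
        refine Convex.is_const_of_fderivWithin_eq_zero (𝕜 := ℂ) (f := fun z => P i z - P j z)
          (convex_ball (x : ℂ) ρ) ?_ ?_ hy (Metric.mem_ball_self hρ)
        · intro z hz
          exact ((hP i z (hsub hz).1).sub (hP j z (hsub hz).2)).differentiableAt.differentiableWithinAt
        · intro z hz
          rw [fderivWithin_of_isOpen Metric.isOpen_ball hz]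
          have := ((hP i z (hsub hz).1).sub (hP j z (hsub hz).2)).hasFDerivAt.fderiv
          have h2 : fderiv ℂ (fun z => P i z - P j z) z = _ := this
          rw [h2]; simp
      have : ∀ᶠ y : Ω in 𝓝 x, (y : ℂ) ∈ Metric.ball (x : ℂ) ρ :=
        continuous_subtype_val.continuousAt.eventually (Metric.ball_mem_nhds _ hρ)
      filter_upwards [this] with y hy
      exact hconst y hy)
  refine ⟨fun z => if hz : z ∈ Ω then G ⟨z, hz⟩ else 0, fun z hz => ?_⟩
  have h1 := hG ⟨z, hz⟩
  rw [nhds_subtype_eq_comap, eventually_comap] at h1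
  have h2 : HasDerivAt (fun y => P ⟨z, hz⟩ y + (G ⟨z, hz⟩ - P ⟨z, hz⟩ z)) (h z) z :=
    (hP ⟨z, hz⟩ z (Metric.mem_ball_self (hr0 _))).add_const _
  refine h2.congr_of_eventuallyEq ?_
  filter_upwards [h1, hopen.mem_nhds hz] with y hy hyΩ
  rw [dif_pos hyΩ]
  have := hy ⟨y, hyΩ⟩ rfl
  rw [← this]; ring

end Hedgehog

/-! ### Maximum principle and harmonic measure -/

namespace Hedgehog

/-- A function that is continuous on a circle, bounded above there by its mean, is constant on the
circle. -/
theorem eq_of_le_of_le_circleAverage {s : ℂ → ℝ} {z : ℂ} {r M : ℝ} (hr : 0 < r)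
    (hs : ContinuousOn s (Metric.sphere z r)) (hle : ∀ x ∈ Metric.sphere z r, s x ≤ M)
    (hM : M ≤ Real.circleAverage s z r) : s (z + r) = M := by
  by_contra hne
  have hmem : ∀ θ, circleMap z r θ ∈ Metric.sphere z r := fun θ => circleMap_mem_sphere z hr.le θ
  have hc : Continuous fun θ => s (circleMap z r θ) := by
    refine hs.comp_continuous (continuous_circleMap z r) hmem
  have h0 : s (circleMap z r 0) < M := by
    have : circleMap z r 0 = z + r := by simp [circleMap]
    rw [this]
    refine lt_of_le_of_ne (hle _ ?_) hne
    rw [← this]; exact hmem 0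
  have hlt : ∫ θ in (0 : ℝ)..2 * Real.pi, s (circleMap z r θ) < ∫ θ in (0 : ℝ)..2 * Real.pi, M := by
    refine intervalIntegral.integral_lt_integral_of_continuousOn_of_le_of_exists_lt
      Real.two_pi_pos hc.continuousOn continuousOn_const (fun θ _ => hle _ (hmem θ))
      ⟨0, ⟨le_rfl, Real.two_pi_pos.le⟩, h0⟩
  rw [Real.circleAverage_def] at hM
  rw [intervalIntegral.integral_const, sub_zero, smul_eq_mul] at hlt
  rw [smul_eq_mul] at hM
  have hpi := Real.two_pi_pos
  have : (2 * Real.pi)⁻¹ * ∫ θ in (0 : ℝ)..2 * Real.pi, s (circleMap z r θ) < M := by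
    rw [inv_mul_lt_iff₀ hpi]; exact hlt
  linarith

/-- The maximum principle for continuous subharmonic functions on bounded open sets. -/
theorem IsContSubharmonicOn.nonpos {s : ℂ → ℝ} {Ω : Set ℂ} (hs : IsContSubharmonicOn s Ω)
    (hopen : IsOpen Ω) (hbdd : Bornology.IsBounded Ω)
    (hb : ∀ ζ ∈ frontier Ω, ∀ ε : ℝ, 0 < ε → ∀ᶠ z in 𝓝[Ω] ζ, s z < ε) :
    ∀ z ∈ Ω, s z ≤ 0 := by
  intro z₁ hz₁
  by_contra hpos
  push Not at hpos
  -- The boundary condition keeps the superlevel sets of positive level away from the frontier, so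
  -- they are compact and the supremum is attained.
  have hcomp : ∀ m, 0 < m → IsCompact {z | z ∈ Ω ∧ m ≤ s z} := by
    intro m hm
    refine Metric.isCompact_of_isClosed_isBounded ?_ (hbdd.subset fun z hz => hz.1)
    rw [← closure_subset_iff_isClosed]
    intro z hz
    have hzc : z ∈ closure Ω := closure_mono (fun w hw => hw.1) hz
    have hfr : ∃ᶠ w in 𝓝 z, w ∈ {z | z ∈ Ω ∧ m ≤ s z} := mem_closure_iff_frequently.1 hz
    by_cases hzΩ : z ∈ Ω
    · refine ⟨hzΩ, ?_⟩
      by_contra hlt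
      push Not at hlt
      have := (hs.1.continuousAt (hopen.mem_nhds hzΩ)).eventually (gt_mem_nhds hlt)
      obtain ⟨w, hw, hw'⟩ := (hfr.and_eventually this).exists
      exact absurd hw.2 (not_le.2 hw')
    · have hzf : z ∈ frontier Ω := ⟨hzc, by rwa [hopen.interior_eq]⟩
      have := eventually_nhdsWithin_iff.1 (hb z hzf m hm)
      obtain ⟨w, hw, hw'⟩ := (hfr.and_eventually this).exists
      exact absurd hw.2 (not_le.2 (hw' hw.1))
  have hcont : ContinuousOn s {z | z ∈ Ω ∧ s z₁ ≤ s z} := hs.1.mono fun z hz => hz.1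
  obtain ⟨z₂, hz₂, hmax⟩ := (hcomp _ hpos).exists_isMaxOn ⟨z₁, hz₁, le_rfl⟩ hcont
  have hM : ∀ z ∈ Ω, s z ≤ s z₂ := by
    intro z hz
    by_cases h : s z₁ ≤ s z
    · exact hmax ⟨hz, h⟩
    · exact (le_of_not_ge h).trans hz₂.2
  -- Among the maximum points, take one with the largest real part. The mean value inequality makes
  -- the point `r / 2` to its right a maximum point as well.
  obtain ⟨z₃, hz₃, hre⟩ := (hcomp (s z₂) (hpos.trans_le hz₂.2)).exists_isMaxOn
    ⟨z₂, hz₂.1, le_rfl⟩ Complex.continuous_re.continuousOn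
  obtain ⟨r, hr, hball⟩ := Metric.isOpen_iff.1 hopen z₃ hz₃.1
  have hcb : Metric.closedBall z₃ (r / 2) ⊆ Ω :=
    (Metric.closedBall_subset_ball (by linarith)).trans hball
  have hr2 : 0 < r / 2 := by linarith
  have hkey := eq_of_le_of_le_circleAverage hr2
    (hs.1.mono (Metric.sphere_subset_closedBall.trans hcb))
    (fun x hx => hM x (hcb (Metric.sphere_subset_closedBall hx)))
    (hz₃.2.trans (hs.2 z₃ hz₃.1 _ hr2 hcb))
  have hmem : z₃ + ((r / 2 : ℝ) : ℂ) ∈ Ω := by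
    apply hcb
    rw [Metric.mem_closedBall, dist_eq_norm, add_sub_cancel_left, Complex.norm_real,
      Real.norm_of_nonneg hr2.le]
  have := hre ⟨hmem, hkey.ge⟩
  simp only [Set.mem_ofPred_eq, Complex.add_re, Complex.ofReal_re] at this
  linarith

theorem IsContSubharmonicOn.of_harmonicOnNhd {u : ℂ → ℝ} {Ω : Set ℂ}
    (hu : InnerProductSpace.HarmonicOnNhd u Ω) : IsContSubharmonicOn u Ω := by
  refine ⟨hu.continuousOn, fun z _ r hr hsub => ?_⟩
  rw [InnerProductSpace.HarmonicOnNhd.circleAverage_eq (hu.mono (by rwa [abs_of_pos hr]))]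

theorem IsContSubharmonicOn.sub_harmonicOnNhd {s u : ℂ → ℝ} {Ω : Set ℂ}
    (hs : IsContSubharmonicOn s Ω) (hu : InnerProductSpace.HarmonicOnNhd u Ω) :
    IsContSubharmonicOn (fun z => s z - u z) Ω := by
  refine ⟨hs.1.sub hu.continuousOn, fun z hz r hr hsub => ?_⟩
  have hsph : Metric.sphere z r ⊆ Ω := Metric.sphere_subset_closedBall.trans hsub
  rw [Real.circleAverage_fun_sub ((hs.1.mono hsph).circleIntegrable hr.le)
    ((hu.continuousOn.mono hsph).circleIntegrable hr.le),
    InnerProductSpace.HarmonicOnNhd.circleAverage_eq (hu.mono (by rwa [abs_of_pos hr]))]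
  exact sub_le_sub_right (hs.2 z hz r hr hsub) _

/-- A harmonic function with the boundary values `1_A` off an exceptional set `P`, at which it is
dominated by every positive multiple of a positive harmonic function, is the harmonic measure
of `A`. -/
theorem harmonicMeasure_eq_of_barrier {Ω A P : Set ℂ} (hopen : IsOpen Ω)
    (hbdd : Bornology.IsBounded Ω) {u b : ℂ → ℝ} (hu : InnerProductSpace.HarmonicOnNhd u Ω)
    (hb : InnerProductSpace.HarmonicOnNhd b Ω) (hb0 : ∀ z ∈ Ω, 0 ≤ b z)
    (hreg : ∀ ζ ∈ frontier Ω, ζ ∉ P →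
      Tendsto u (𝓝[Ω] ζ) (𝓝 (A.indicator (fun _ => (1 : ℝ)) ζ)))
    (hsing : ∀ ζ ∈ P, ∀ ε : ℝ, 0 < ε → Tendsto (fun z => ε * b z - u z) (𝓝[Ω] ζ) atTop ∧
      Tendsto (fun z => ε * b z + u z) (𝓝[Ω] ζ) atTop) {w : ℂ} (hw : w ∈ Ω) :
    harmonicMeasure Ω A w = u w := by
  have hεb : ∀ ε : ℝ, InnerProductSpace.HarmonicOnNhd (fun z => ε * b z) Ω := fun ε =>
    hb.const_smul (c := ε)
  have hind0 : ∀ ζ, 0 ≤ A.indicator (fun _ => (1 : ℝ)) ζ := fun ζ =>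
    indicator_nonneg (fun _ _ => zero_le_one) ζ
  have hind1 : ∀ ζ, A.indicator (fun _ => (1 : ℝ)) ζ ≤ 1 := fun ζ =>
    indicator_apply_le' (fun _ => le_rfl) (fun _ => zero_le_one)
  have hmemΩ : ∀ ζ, ∀ᶠ z in 𝓝[Ω] ζ, z ∈ Ω := fun ζ => self_mem_nhdsWithin
  -- `u - ε b` belongs to the Perron family: at `P` it tends to `-∞`, elsewhere it lies below `u`.
  have hmem : ∀ ε : ℝ, 0 < ε → ∃ s : ℂ → ℝ, IsContSubharmonicOn s Ω ∧
    (∀ ζ ∈ frontier Ω, ∀ ε : ℝ, 0 < ε → ∀ᶠ z in 𝓝[Ω] ζ, s z < A.indicator (fun _ => 1) ζ + ε) ∧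
    u w - ε * b w = s w := by
    intro ε hε
    refine ⟨fun z => u z - ε * b z,
      (IsContSubharmonicOn.of_harmonicOnNhd hu).sub_harmonicOnNhd (hεb ε), ?_, rfl⟩
    intro ζ hζ η hη
    by_cases hP : ζ ∈ P
    · filter_upwards [(hsing ζ hP ε hε).1.eventually_gt_atTop 0] with z hz
      have := hind0 ζ
      linarith
    · filter_upwards [(hreg ζ hζ hP).eventually
        (gt_mem_nhds (lt_add_of_pos_right _ hη)), hmemΩ ζ] with z hz hzΩ
      have := mul_nonneg hε.le (hb0 z hzΩ)
      linarith
  have hle : ∀ x ∈ {x : ℝ | ∃ s : ℂ → ℝ, IsContSubharmonicOn s Ω ∧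
    (∀ ζ ∈ frontier Ω, ∀ ε : ℝ, 0 < ε → ∀ᶠ z in 𝓝[Ω] ζ, s z < A.indicator (fun _ => 1) ζ + ε) ∧
    x = s w}, x ≤ u w := by
    rintro x ⟨s, hs, hsb, rfl⟩
    have hε : ∀ ε : ℝ, 0 < ε → s w ≤ u w + ε * b w := by
      intro ε hε
      have := (hs.sub_harmonicOnNhd hu).sub_harmonicOnNhd (hεb ε)
      have := this.nonpos hopen hbdd (by
        intro ζ hζ η hη
        by_cases hP : ζ ∈ P
        -- Near `ζ` the competitor stays below `1 + 1`, so the level 2 suffices.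
        · filter_upwards [(hsing ζ hP ε hε).2.eventually_gt_atTop 2, hsb ζ hζ 1 one_pos]
            with z hz hz'
          have := hind1 ζ
          linarith
        · filter_upwards [(hreg ζ hζ hP).eventually
            (lt_mem_nhds (sub_lt_self _ (half_pos hη))), hmemΩ ζ, hsb ζ hζ _ (half_pos hη)]
            with z hz hzΩ hz'
          have := mul_nonneg hε.le (hb0 z hzΩ)
          linarith) w hw
      linarith
    have hbw := hb0 w hw
    -- The `+ 1` keeps the denominator positive even where `b w = 0`.
    refine le_of_forall_pos_le_add fun η hη => (hε (η / (b w + 1)) (by positivity)).trans ?_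
    have : η / (b w + 1) * b w ≤ η := by
      rw [div_mul_eq_mul_div, div_le_iff₀ (by positivity)]
      nlinarith
    linarith
  have hbd : BddAbove {x : ℝ | ∃ s : ℂ → ℝ, IsContSubharmonicOn s Ω ∧
    (∀ ζ ∈ frontier Ω, ∀ ε : ℝ, 0 < ε → ∀ᶠ z in 𝓝[Ω] ζ, s z < A.indicator (fun _ => 1) ζ + ε) ∧
    x = s w} := ⟨u w, hle⟩
  apply le_antisymm
  · exact csSup_le ⟨_, hmem 1 one_pos⟩ hle
  · have hbw := hb0 w hw
    refine le_of_forall_pos_le_add fun η hη => ?_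
    have h1 := le_csSup hbd (hmem (η / (b w + 1)) (by positivity))
    have : η / (b w + 1) * b w ≤ η := by
      rw [div_mul_eq_mul_div, div_le_iff₀ (by positivity)]
      nlinarith
    unfold harmonicMeasure
    linarith

end Hedgehog

/-! ### Boundary charts -/

namespace Hedgehog

/-- Coordinates near the boundary point `β t₀`: arc length along the boundary and translation in
the direction of the inner normal at `β t₀`. -/
noncomputable def boundaryChart (β : ℝ → ℂ) (t₀ : ℝ) (x : ℝ × ℝ) : ℂ :=
  β x.1 + (x.2 : ℂ) * (Complex.I * deriv β t₀)

/-- The derivative of `boundaryChart β t₀` at `(t₀, 0)`, where `τ = β' t₀`. -/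
noncomputable def chartDeriv (τ : ℂ) : ℝ × ℝ →L[ℝ] ℂ :=
  (ContinuousLinearMap.fst ℝ ℝ ℝ).smulRight τ +
    (ContinuousLinearMap.snd ℝ ℝ ℝ).smulRight (Complex.I * τ)

theorem chartDeriv_apply (τ : ℂ) (x : ℝ × ℝ) :
    chartDeriv τ x = (x.1 + x.2 * Complex.I) * τ := by
  simp [chartDeriv]; ring

theorem norm_le_norm_chartDeriv {τ : ℂ} (hτ : ‖τ‖ = 1) (x : ℝ × ℝ) : ‖x‖ ≤ ‖chartDeriv τ x‖ := by
  rw [chartDeriv_apply, norm_mul, hτ, mul_one]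
  have h1 := Complex.abs_re_le_norm (x.1 + x.2 * Complex.I)
  have h2 := Complex.abs_im_le_norm (x.1 + x.2 * Complex.I)
  simp at h1 h2
  exact max_le h1 h2

theorem norm_chartDeriv_le {τ : ℂ} (hτ : ‖τ‖ = 1) (x : ℝ × ℝ) : ‖chartDeriv τ x‖ ≤ 2 * ‖x‖ := by
  rw [chartDeriv_apply, norm_mul, hτ, mul_one]
  have h1 : ‖x.1‖ ≤ ‖x‖ := norm_fst_le x
  have h2 : ‖x.2‖ ≤ ‖x‖ := norm_snd_le x
  have := norm_add_le (x.1 : ℂ) (x.2 * Complex.I)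
  simp only [Complex.norm_real, norm_mul, Complex.norm_I, mul_one] at this
  linarith

theorem chartDeriv_surjective {τ : ℂ} (hτ : ‖τ‖ = 1) : Function.Surjective (chartDeriv τ) := by
  intro z
  have h0 : τ ≠ 0 := by rintro rfl; simp at hτ
  refine ⟨((z / τ).re, (z / τ).im), ?_⟩
  rw [chartDeriv_apply]
  simp only [Complex.re_add_im]
  field_simp

namespace IsSmoothBoundaryParam

variable {Ω : Set ℂ} {β : ℝ → ℂ} {L : ℝ}

theorem differentiable (hβ : IsSmoothBoundaryParam Ω β L) : Differentiable ℝ β :=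
  hβ.contDiff.differentiable (by simp)

theorem continuous_deriv (hβ : IsSmoothBoundaryParam Ω β L) : Continuous (deriv β) :=
  hβ.contDiff.continuous_deriv (by simp)

theorem hasDerivAt (hβ : IsSmoothBoundaryParam Ω β L) (t : ℝ) : HasDerivAt β (deriv β t) t :=
  (hβ.differentiable t).hasDerivAt

theorem mem_frontier (hβ : IsSmoothBoundaryParam Ω β L) (t : ℝ) : β t ∈ frontier Ω :=
  hβ.range_eq ▸ mem_range_self t

theorem eq_add_of_eq (hβ : IsSmoothBoundaryParam Ω β L) {s t : ℝ} (h : β s = β t) :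
    ∃ k : ℤ, s = t + k * L := by
  have hmod : ∀ x, β (toIcoMod hβ.length_pos 0 x) = β x := fun x =>
    hβ.periodic.sub_zsmul_eq (toIcoDiv hβ.length_pos 0 x)
  have hmem : ∀ x, toIcoMod hβ.length_pos 0 x ∈ Ico 0 L := fun x => by
    simpa using toIcoMod_mem_Ico hβ.length_pos 0 x
  have := hβ.injOn (hmem s) (hmem t) (by rw [hmod, hmod, h])
  refine ⟨toIcoDiv hβ.length_pos 0 s - toIcoDiv hβ.length_pos 0 t, ?_⟩
  have h1 := toIcoMod_add_toIcoDiv_zsmul hβ.length_pos 0 s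
  have h2 := toIcoMod_add_toIcoDiv_zsmul hβ.length_pos 0 t
  rw [zsmul_eq_mul] at h1 h2
  push_cast
  linarith

theorem add_int_mul (hβ : IsSmoothBoundaryParam Ω β L) (t : ℝ) (k : ℤ) : β (t + k * L) = β t := by
  simpa using hβ.periodic.zsmul k t

theorem exists_mem_Ico_eq (hβ : IsSmoothBoundaryParam Ω β L) (a s : ℝ) :
    ∃ t ∈ Ico a (a + L), β t = β s :=
  ⟨toIcoMod hβ.length_pos a s, toIcoMod_mem_Ico hβ.length_pos a s,
    hβ.periodic.sub_zsmul_eq (toIcoDiv hβ.length_pos a s)⟩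

theorem boundaryChart_zero (t₀ t : ℝ) : boundaryChart β t₀ (t, 0) = β t := by
  simp [boundaryChart]

theorem hasStrictFDerivAt_boundaryChart (hβ : IsSmoothBoundaryParam Ω β L) (t₀ : ℝ) :
    HasStrictFDerivAt (boundaryChart β t₀) (chartDeriv (deriv β t₀)) (t₀, 0) := by
  have h1 : HasStrictFDerivAt β (ContinuousLinearMap.toSpanSingleton ℝ (deriv β t₀)) t₀ :=
    (hβ.contDiff.contDiffAt.hasStrictDerivAt (by simp)).hasStrictFDerivAt
  have h2 : HasStrictFDerivAt (fun x : ℝ × ℝ => β x.1)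
      ((ContinuousLinearMap.toSpanSingleton ℝ (deriv β t₀)).comp (ContinuousLinearMap.fst ℝ ℝ ℝ))
      (t₀, 0) :=
    HasStrictFDerivAt.comp (t₀, (0 : ℝ)) h1 hasStrictFDerivAt_fst
  have h3 := h2.add ((ContinuousLinearMap.snd ℝ ℝ ℝ).smulRight
    (Complex.I * deriv β t₀)).hasStrictFDerivAt
  have e1 : boundaryChart β t₀ = (fun x : ℝ × ℝ => β x.1) +
      ⇑((ContinuousLinearMap.snd ℝ ℝ ℝ).smulRight (Complex.I * deriv β t₀)) := by
    ext x; simp [boundaryChart]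
  have e2 : chartDeriv (deriv β t₀) =
      (ContinuousLinearMap.toSpanSingleton ℝ (deriv β t₀)).comp (ContinuousLinearMap.fst ℝ ℝ ℝ) +
        (ContinuousLinearMap.snd ℝ ℝ ℝ).smulRight (Complex.I * deriv β t₀) := by
    ext <;> simp [chartDeriv]
  rw [e1, e2]
  exact h3

theorem continuous_boundaryChart (hβ : IsSmoothBoundaryParam Ω β L) (t₀ : ℝ) :
    Continuous (boundaryChart β t₀) := by
  unfold boundaryChart
  have := hβ.contDiff.continuous
  fun_prop

/-- Near a boundary point, `Ω` is the part of a coordinate box in which the normal coordinate is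
positive. -/
theorem eventually_boundaryChart (hβ : IsSmoothBoundaryParam Ω β L) (hopen : IsOpen Ω) (t₀ : ℝ) :
    ∀ᶠ δ : ℝ in 𝓝[>] 0,
      boundaryChart β t₀ '' Metric.ball (t₀, 0) δ ∈ 𝓝 (β t₀) ∧
      (∀ x ∈ Metric.ball ((t₀, 0) : ℝ × ℝ) δ, ∀ y ∈ Metric.ball ((t₀, 0) : ℝ × ℝ) δ,
        ‖boundaryChart β t₀ x - boundaryChart β t₀ y - chartDeriv (deriv β t₀) (x - y)‖ ≤
          1 / 4 * ‖x - y‖) ∧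
      ∀ x ∈ Metric.ball ((t₀, 0) : ℝ × ℝ) δ, boundaryChart β t₀ x ∈ Ω ↔ 0 < x.2 := by
  have hstrict := hβ.hasStrictFDerivAt_boundaryChart t₀
  have hcont := hβ.continuous_boundaryChart t₀
  have hp : boundaryChart β t₀ (t₀, 0) = β t₀ := boundaryChart_zero t₀ t₀
  have hτ := hβ.unit_speed t₀
  have hmap := hstrict.map_nhds_eq_of_surj
    (LinearMap.range_eq_top.2 (chartDeriv_surjective hτ))
  rw [hp] at hmap
  have happ : ∃ δ₁ > 0, ∀ x ∈ Metric.ball ((t₀, 0) : ℝ × ℝ) δ₁,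
      ∀ y ∈ Metric.ball ((t₀, 0) : ℝ × ℝ) δ₁,
        ‖boundaryChart β t₀ x - boundaryChart β t₀ y - chartDeriv (deriv β t₀) (x - y)‖ ≤
          1 / 4 * ‖x - y‖ := by
    have := hstrict.isLittleO.def (show (0 : ℝ) < 1 / 4 by norm_num)
    rw [nhds_prod_eq] at this
    obtain ⟨t, ht, hxy⟩ := mem_prod_self_iff.1 this
    obtain ⟨δ₁, hδ₁, hsub⟩ := Metric.mem_nhds_iff.1 ht
    exact ⟨δ₁, hδ₁, fun x hx y hy => hxy (mk_mem_prod (hsub hx) (hsub hy))⟩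
  obtain ⟨δ₁, hδ₁, happ⟩ := happ
  have hinj : InjOn (boundaryChart β t₀) (Metric.ball (t₀, 0) δ₁) := by
    intro x hx y hy hxy
    have h1 := happ x hx y hy
    rw [hxy, sub_self, zero_sub, norm_neg] at h1
    have h2 := norm_le_norm_chartDeriv hτ (x - y)
    have : ‖x - y‖ = 0 := by
      have := norm_nonneg (x - y)
      linarith
    exact sub_eq_zero.1 (norm_eq_zero.1 this)
  have hL := hβ.length_pos
  -- The part of the boundary with parameters away from `t₀` within one period is compact and misses
  -- `β t₀`. Near `β t₀` the frontier is therefore only the image of the axis `x.2 = 0`.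
  have hK : IsCompact (β '' (Icc (t₀ - L / 2) (t₀ + L / 2) \ Ioo (t₀ - δ₁) (t₀ + δ₁))) :=
    (isCompact_Icc.diff isOpen_Ioo).image hβ.contDiff.continuous
  have hpK : β t₀ ∉ β '' (Icc (t₀ - L / 2) (t₀ + L / 2) \ Ioo (t₀ - δ₁) (t₀ + δ₁)) := by
    rintro ⟨s, ⟨hs, hs'⟩, hst⟩
    obtain ⟨k, rfl⟩ := hβ.eq_add_of_eq hst
    have hk : k = 0 := by
      have h1 : (k : ℝ) < 1 := by nlinarith [hs.2]
      have h2 : (-1 : ℝ) < k := by nlinarith [hs.1]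
      have h1' : k < 1 := by exact_mod_cast h1
      have h2' : -1 < k := by exact_mod_cast h2
      omega
    subst hk
    exact hs' ⟨by simp; linarith, by simp; linarith⟩
  have hev : ∀ᶠ x in 𝓝 ((t₀, 0) : ℝ × ℝ), boundaryChart β t₀ x ∉
      β '' (Icc (t₀ - L / 2) (t₀ + L / 2) \ Ioo (t₀ - δ₁) (t₀ + δ₁)) :=
    hcont.continuousAt.eventually (by rw [hp]; exact hK.isClosed.isOpen_compl.mem_nhds hpK)
  obtain ⟨δ₂, hδ₂, hev⟩ := Metric.eventually_nhds_iff_ball.1 hev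
  filter_upwards [Ioo_mem_nhdsGT (lt_min hδ₁ hδ₂)] with δ hδ
  have hδ0 : 0 < δ := hδ.1
  have hb1 : Metric.ball ((t₀, 0) : ℝ × ℝ) δ ⊆ Metric.ball (t₀, 0) δ₁ :=
    Metric.ball_subset_ball (hδ.2.le.trans (min_le_left _ _))
  have hb2 : Metric.ball ((t₀, 0) : ℝ × ℝ) δ ⊆ Metric.ball (t₀, 0) δ₂ :=
    Metric.ball_subset_ball (hδ.2.le.trans (min_le_right _ _))
  have hfr : ∀ x ∈ Metric.ball ((t₀, 0) : ℝ × ℝ) δ, boundaryChart β t₀ x ∈ frontier Ω →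
      x.2 = 0 := by
    intro x hx hxf
    rw [← hβ.range_eq] at hxf
    obtain ⟨s', hs'⟩ := hxf
    obtain ⟨s, hs, hss⟩ := hβ.exists_mem_Ico_eq (t₀ - L / 2) s'
    have hsI : s ∈ Ioo (t₀ - δ₁) (t₀ + δ₁) := by
      by_contra hne
      exact hev x (hb2 hx) ⟨s, ⟨⟨hs.1, by linarith [hs.2]⟩, hne⟩, hss.trans hs'⟩
    have hsb : ((s, 0) : ℝ × ℝ) ∈ Metric.ball (t₀, 0) δ₁ := by
      rw [← ball_prod_same]
      exact ⟨by rw [Real.ball_eq_Ioo]; exact hsI, Metric.mem_ball_self hδ₁⟩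
    have := hinj (hb1 hx) hsb (by rw [boundaryChart_zero, hss, hs'])
    rw [this]
  have hline : ∀ ε : ℝ, |ε| < δ → ((t₀, ε) : ℝ × ℝ) ∈ Metric.ball (t₀, 0) δ := by
    intro ε hε
    rw [← ball_prod_same]
    exact ⟨Metric.mem_ball_self hδ0, by simpa using hε⟩
  have hΩ0 : Disjoint Ω (closure Ω)ᶜ :=
    disjoint_compl_right_iff_subset.2 subset_closure
  -- Each open half of the box is connected and its image misses the frontier, so it lies entirely
  -- in `Ω` or entirely outside the closure. One point on the normal line decides which.
  have hdich : ∀ S : Set (ℝ × ℝ), S ⊆ Metric.ball (t₀, 0) δ → (∀ x ∈ S, x.2 ≠ 0) →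
      boundaryChart β t₀ '' S ⊆ Ω ∪ (closure Ω)ᶜ := by
    rintro S hS hne _ ⟨x, hx, rfl⟩
    by_contra hcon
    simp only [mem_union, mem_compl_iff, not_or, not_not] at hcon
    exact hne x hx (hfr x (hS hx) ⟨hcon.2, by rw [hopen.interior_eq]; exact hcon.1⟩)
  have hpos : boundaryChart β t₀ '' (Metric.ball (t₀, 0) δ ∩ {x | 0 < x.2}) ⊆ Ω := by
    refine IsPreconnected.subset_left_of_subset_union hopen isClosed_closure.isOpen_compl hΩ0
      (hdich _ inter_subset_left fun x hx => (show 0 < x.2 from hx.2).ne') ?_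
      (((convex_ball _ _).inter (convex_halfSpace_gt
        (IsLinearMap.mk (fun _ _ => rfl) fun _ _ => rfl) 0)).isPreconnected.image _
          hcont.continuousOn)
    obtain ⟨ε, hε, hεI⟩ := ((hβ.left_mem t₀).and (Ioo_mem_nhdsGT hδ0)).exists
    exact ⟨_, ⟨(t₀, ε), ⟨hline ε (by rw [abs_of_pos hεI.1]; exact hεI.2), hεI.1⟩, rfl⟩, hε⟩
  have hneg : boundaryChart β t₀ '' (Metric.ball (t₀, 0) δ ∩ {x | x.2 < 0}) ⊆ (closure Ω)ᶜ := by
    refine IsPreconnected.subset_right_of_subset_union hopen isClosed_closure.isOpen_compl hΩ0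
      (hdich _ inter_subset_left fun x hx => (show x.2 < 0 from hx.2).ne) ?_
      (((convex_ball _ _).inter (convex_halfSpace_lt
        (IsLinearMap.mk (fun _ _ => rfl) fun _ _ => rfl) 0)).isPreconnected.image _
          hcont.continuousOn)
    obtain ⟨ε, hε, hεI⟩ := ((hβ.right_notMem t₀).and (Ioo_mem_nhdsGT hδ0)).exists
    refine ⟨_, ⟨(t₀, -ε), ⟨hline (-ε) (by rw [abs_neg, abs_of_pos hεI.1]; exact hεI.2),
      neg_lt_zero.2 hεI.1⟩, rfl⟩, ?_⟩
    simpa [boundaryChart, sub_eq_add_neg] using hε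
  refine ⟨?_, fun x hx y hy => happ x (hb1 hx) y (hb1 hy), fun x hx => ⟨fun hxΩ => ?_, fun hx0 =>
    hpos ⟨x, ⟨hx, hx0⟩, rfl⟩⟩⟩
  · rw [← hmap]
    exact image_mem_map (Metric.ball_mem_nhds _ hδ0)
  · rcases lt_trichotomy x.2 0 with h | h | h
    · exact absurd (subset_closure hxΩ) (hneg ⟨x, ⟨hx, h⟩, rfl⟩)
    · exfalso
      have hx0 : boundaryChart β t₀ x = β x.1 := by simp [boundaryChart, h]
      rw [hx0] at hxΩ
      have := (hβ.mem_frontier x.1).2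
      rw [hopen.interior_eq] at this
      exact this hxΩ
    · exact h

end IsSmoothBoundaryParam

end Hedgehog

/-! ### Boundary behaviour of the real part of a primitive -/

namespace Hedgehog

theorem hasDerivAt_re_comp {F : ℂ → ℂ} {φ : ℝ → ℂ} {t : ℝ} {h φ' : ℂ}
    (hF : HasDerivAt F h (φ t)) (hφ : HasDerivAt φ φ' t) :
    HasDerivAt (fun s => (F (φ s)).re) (h * φ').re t := by
  have h1 : HasDerivAt (F ∘ φ) (φ' • h) t := hF.scomp t hφ
  have h2 := Complex.reCLM.hasFDerivAt.comp_hasDerivAt t h1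
  have e : Complex.reCLM (φ' • h) = (h * φ').re := by
    simp [mul_comm]
  rw [← e]
  exact h2

theorem hasDerivAt_boundaryChart_snd (β : ℝ → ℂ) (t₀ t ε : ℝ) :
    HasDerivAt (fun e => boundaryChart β t₀ (t, e)) (Complex.I * deriv β t₀) ε := by
  have h1 : HasDerivAt (fun e : ℝ => (e : ℂ)) 1 ε := Complex.ofRealCLM.hasDerivAt
  have h2 := (h1.mul_const (Complex.I * deriv β t₀)).const_add (β t)
  rw [one_mul] at h2
  exact h2

theorem norm_I_mul_of_norm_one {τ : ℂ} (hτ : ‖τ‖ = 1) : ‖Complex.I * τ‖ = 1 := by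
  rw [norm_mul, Complex.norm_I, one_mul, hτ]

/-- Mean value inequality with a comparison function, applied below with `B` linear for bounded `h`
and logarithmic at a pole. -/
theorem norm_sub_le_of_hasDerivAt {f B B' : ℝ → ℝ} {f' : ℝ → ℝ} {a b : ℝ} (hab : a ≤ b)
    (hf : ∀ x ∈ Icc a b, HasDerivAt f (f' x) x) (hB : ∀ x ∈ Icc a b, HasDerivAt B (B' x) x)
    (hle : ∀ x ∈ Icc a b, |f' x| ≤ B' x) : |f b - f a| ≤ B b - B a := by
  have h := image_norm_le_of_norm_deriv_right_le_deriv_boundary' (f := fun x => f x - f a)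
    (B := fun x => B x - B a) (a := a) (b := b) (f' := f') (B' := B')
    (fun x hx => ((hf x hx).sub_const _).continuousAt.continuousWithinAt)
    (fun x hx => ((hf x (Ico_subset_Icc_self hx)).sub_const _).hasDerivWithinAt) (by simp)
    (fun x hx => ((hB x hx).sub_const _).continuousAt.continuousWithinAt)
    (fun x hx => ((hB x (Ico_subset_Icc_self hx)).sub_const _).hasDerivWithinAt)
    (fun x hx => hle x (Ico_subset_Icc_self hx))
  exact h ⟨hab, le_rfl⟩

/-- The chart differs from its derivative, which does not shrink the sup norm, by at most a quarter
of the distance. The sharp constant would be 4/3. -/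
theorem norm_sub_le_two_mul {Φ : ℝ × ℝ → ℂ} {τ : ℂ} (hτ : ‖τ‖ = 1) {x y : ℝ × ℝ}
    (h : ‖Φ x - Φ y - chartDeriv τ (x - y)‖ ≤ 1 / 4 * ‖x - y‖) :
    ‖x - y‖ ≤ 2 * ‖Φ x - Φ y‖ := by
  have h1 := norm_le_norm_chartDeriv hτ (x - y)
  have h2 := norm_sub_norm_le (chartDeriv τ (x - y)) (Φ x - Φ y)
  rw [norm_sub_rev (chartDeriv τ (x - y))] at h2
  have := norm_nonneg (x - y)
  linarith

theorem norm_map_sub_le_three_mul {Φ : ℝ × ℝ → ℂ} {τ : ℂ} (hτ : ‖τ‖ = 1) {x y : ℝ × ℝ}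
    (h : ‖Φ x - Φ y - chartDeriv τ (x - y)‖ ≤ 1 / 4 * ‖x - y‖) :
    ‖Φ x - Φ y‖ ≤ 3 * ‖x - y‖ := by
  have h1 := norm_chartDeriv_le hτ (x - y)
  have h2 := norm_sub_norm_le (Φ x - Φ y) (chartDeriv τ (x - y))
  have := norm_nonneg (x - y)
  linarith

theorem mem_ball_prod_iff {t₀ δ : ℝ} {x : ℝ × ℝ} :
    x ∈ Metric.ball ((t₀, 0) : ℝ × ℝ) δ ↔ |x.1 - t₀| < δ ∧ |x.2| < δ := by
  rw [← ball_prod_same, mem_prod, Metric.mem_ball, Metric.mem_ball, Real.dist_eq, Real.dist_eq,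
    sub_zero]

namespace IsSmoothBoundaryParam

variable {Ω : Set ℂ} {β : ℝ → ℂ} {L : ℝ}

/-- Near a boundary point where `h` is continuous, the real part of a primitive of `h` has a
constant boundary value if `Re [h(z) dz]` vanishes along the boundary. -/
theorem exists_eventually_tendsto_re (hβ : IsSmoothBoundaryParam Ω β L) (hopen : IsOpen Ω)
    {F h : ℂ → ℂ} {S : Set ℂ} (hF : ∀ z ∈ Ω, HasDerivAt F (h z) z) (hS : IsClosed S)
    (hh : ContinuousOn h (closure Ω \ S))
    (hbd : ∀ t, β t ∉ S → (h (β t) * deriv β t).re = 0) {t₀ : ℝ} (ht₀ : β t₀ ∉ S) :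
    ∃ K : ℝ, ∀ᶠ t in 𝓝 t₀, Tendsto (fun z => (F z).re) (𝓝[Ω] (β t)) (𝓝 K) := by
  have hcont := hβ.continuous_boundaryChart t₀
  have hp : boundaryChart β t₀ (t₀, 0) = β t₀ := boundaryChart_zero t₀ t₀
  have hτ := hβ.unit_speed t₀
  have hSev : ∀ᶠ x in 𝓝 ((t₀, 0) : ℝ × ℝ), boundaryChart β t₀ x ∉ S :=
    hcont.continuousAt.eventually (by rw [hp]; exact hS.isOpen_compl.mem_nhds ht₀)
  obtain ⟨δS, hδS, hSev⟩ := Metric.eventually_nhds_iff_ball.1 hSev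
  obtain ⟨δ₁, hδ₁, hδ₁'⟩ := (nhdsGT_basis (0 : ℝ)).eventually_iff.1
    (hβ.eventually_boundaryChart hopen t₀)
  obtain ⟨δ, hδ0, hδ⟩ : ∃ δ, 0 < δ ∧ δ < min (1 / 2) (min δS δ₁) :=
    exists_between (by positivity)
  have hδ2 : δ < 1 / 2 := hδ.trans_le (min_le_left _ _)
  have hδS' : δ < δS := hδ.trans_le ((min_le_right _ _).trans (min_le_left _ _))
  have hδδ₁ : δ < δ₁ := hδ.trans_le ((min_le_right _ _).trans (min_le_right _ _))
  obtain ⟨δ₂, hδδ₂, hδ₂⟩ := exists_between hδδ₁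
  obtain ⟨hnhds, happ, -⟩ := hδ₁' ⟨hδ0, hδδ₁⟩
  have hΩiff := (hδ₁' ⟨hδ0.trans hδδ₂, hδ₂⟩).2.2
  let Q : Set (ℝ × ℝ) := Metric.closedBall (t₀, 0) δ ∩ {x | 0 ≤ x.2}
  have hQc : IsCompact Q := (isCompact_closedBall _ _).inter_right
    (isClosed_le continuous_const continuous_snd)
  have hQ_mem : ∀ x : ℝ × ℝ, x ∈ Q ↔ |x.1 - t₀| ≤ δ ∧ 0 ≤ x.2 ∧ x.2 ≤ δ := by
    intro x
    simp only [Q, mem_inter_iff, ← closedBall_prod_same, mem_prod, Metric.mem_closedBall,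
      Real.dist_eq, sub_zero, Set.mem_ofPred_eq]
    constructor
    · rintro ⟨⟨h1, h2⟩, h3⟩; exact ⟨h1, h3, (le_abs_self _).trans h2⟩
    · rintro ⟨h1, h2, h3⟩; exact ⟨⟨h1, by rwa [abs_of_nonneg h2]⟩, h2⟩
  have hQΩ : ∀ x ∈ Q, 0 < x.2 → boundaryChart β t₀ x ∈ Ω := by
    intro x hx hx0
    exact (hΩiff x (Metric.closedBall_subset_ball hδδ₂ hx.1)).2 hx0
  have hQmaps : MapsTo (boundaryChart β t₀) Q (closure Ω \ S) := by
    intro x hx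
    refine ⟨?_, hSev x (Metric.closedBall_subset_ball hδS' hx.1)⟩
    rcases (show 0 ≤ x.2 from hx.2).lt_or_eq with h | h
    · exact subset_closure (hQΩ x hx h)
    · have : x = (x.1, 0) := by ext <;> simp [← h]
      rw [this, boundaryChart_zero]
      exact (hβ.mem_frontier x.1).1
  have hk : ContinuousOn (fun x => h (boundaryChart β t₀ x)) Q :=
    hh.comp hcont.continuousOn hQmaps
  obtain ⟨M, hM⟩ := hQc.exists_bound_of_continuousOn hk
  have hM0 : 0 ≤ M := (norm_nonneg _).trans
    (hM (t₀, 0) ((hQ_mem _).2 ⟨by simp [hδ0.le], le_rfl, hδ0.le⟩))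
  have hkt : ContinuousOn (fun x : ℝ × ℝ => (h (boundaryChart β t₀ x) * deriv β x.1).re) Q :=
    Complex.continuous_re.comp_continuousOn
      (hk.mul (hβ.continuous_deriv.comp continuous_fst).continuousOn)
  have hunif := hQc.uniformContinuousOn_of_continuous hkt
  set q : ℝ × ℝ → ℝ := fun x => (F (boundaryChart β t₀ x)).re
  -- Along the normal direction `q` is Lipschitz with constant `M`.
  have hvert : ∀ t e₁ e₂ : ℝ, |t - t₀| ≤ δ → 0 < e₁ → e₁ ≤ e₂ → e₂ ≤ δ →
      |q (t, e₂) - q (t, e₁)| ≤ M * e₂ - M * e₁ := by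
    intro t e₁ e₂ ht he₁ he₁₂ he₂
    have hmem : ∀ e ∈ Icc e₁ e₂, ((t, e) : ℝ × ℝ) ∈ Q := fun e he =>
      (hQ_mem _).2 ⟨ht, (he₁.trans_le he.1).le, he.2.trans he₂⟩
    refine norm_sub_le_of_hasDerivAt (f := fun e => q (t, e)) (B := fun e => M * e)
      (B' := fun _ => M) he₁₂
      (fun e he => hasDerivAt_re_comp (hF _ (hQΩ _ (hmem e he) (he₁.trans_le he.1)))
        (hasDerivAt_boundaryChart_snd β t₀ t e))
      (fun e _ => by simpa using (hasDerivAt_id e).const_mul M) (fun e he => ?_)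
    refine (Complex.abs_re_le_norm _).trans ?_
    rw [norm_mul, norm_I_mul_of_norm_one hτ, mul_one]
    exact hM _ (hmem e he)
  -- The translation direction in the chart is fixed, so the tangent at height `e` is still `deriv β
  -- s`. The derivative of `q` along this curve is uniformly close to its boundary expression `Re [h
  -- β']`, which is 0. Hence the oscillation of `q` at height `e` tends to 0 with `e`.
  have hhor : ∀ η : ℝ, 0 < η → ∃ ε₀ > 0, ∀ e, 0 < e → e < ε₀ → e ≤ δ → ∀ s t,
      |s - t₀| ≤ δ → |t - t₀| ≤ δ → |q (s, e) - q (t, e)| ≤ η := by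
    intro η hη
    obtain ⟨ε₀, hε₀, hε⟩ := Metric.uniformContinuousOn_iff.1 hunif η hη
    refine ⟨ε₀, hε₀, fun e he heε heδ s t hs ht => ?_⟩
    have hconv : Convex ℝ (Metric.closedBall t₀ δ) := convex_closedBall t₀ δ
    have hb : ∀ s ∈ Metric.closedBall t₀ δ,
        ‖(h (boundaryChart β t₀ (s, e)) * deriv β s).re‖ ≤ η := by
      intro s hs
      rw [Metric.mem_closedBall, Real.dist_eq] at hs
      have hsQ : ((s, e) : ℝ × ℝ) ∈ Q := (hQ_mem _).2 ⟨hs, he.le, heδ⟩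
      have hsQ0 : ((s, 0) : ℝ × ℝ) ∈ Q := (hQ_mem _).2 ⟨hs, le_rfl, hδ0.le⟩
      have h1 := hε _ hsQ _ hsQ0 (by
        rw [Prod.dist_eq, dist_self, Real.dist_eq, sub_zero, abs_of_pos he]
        exact max_lt hε₀ heε)
      simp only [boundaryChart_zero] at h1
      rw [hbd s (by simpa [boundaryChart_zero] using (hQmaps hsQ0).2), dist_zero_right] at h1
      exact h1.le
    have := hconv.norm_image_sub_le_of_norm_hasDerivWithin_le (f := fun s => q (s, e)) (C := η)
      (f' := fun s => (h (boundaryChart β t₀ (s, e)) * deriv β s).re)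
      (fun s hs => by
        rw [Metric.mem_closedBall, Real.dist_eq] at hs
        have hd : HasDerivAt (fun s => boundaryChart β t₀ (s, e)) (deriv β s) s :=
          (hβ.hasDerivAt s).add_const ((e : ℂ) * (Complex.I * deriv β t₀))
        exact (hasDerivAt_re_comp (φ := fun s => boundaryChart β t₀ (s, e))
          (hF _ (hQΩ (s, e) ((hQ_mem _).2 ⟨hs, he.le, heδ⟩) he)) hd).hasDerivWithinAt) hb
      (show t ∈ Metric.closedBall t₀ δ by rwa [Metric.mem_closedBall, Real.dist_eq])
      (show s ∈ Metric.closedBall t₀ δ by rwa [Metric.mem_closedBall, Real.dist_eq])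
    refine this.trans ?_
    have hst : ‖s - t‖ ≤ 1 := by
      rw [Real.norm_eq_abs]
      have h1 := abs_le.1 hs
      have h2 := abs_le.1 ht
      exact abs_le.2 ⟨by linarith, by linarith⟩
    nlinarith
  -- Descend from `x` to a tiny height `e`, move sideways at cost `η`, and climb to `y`.
  have hkey : ∀ x ∈ Q, 0 < x.2 → ∀ y ∈ Q, 0 < y.2 → |q x - q y| ≤ M * x.2 + M * y.2 := by
    intro x hx hx0 y hy hy0
    have hx' := (hQ_mem x).1 hx
    have hy' := (hQ_mem y).1 hy
    refine le_of_forall_pos_le_add fun η hη => ?_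
    obtain ⟨ε₀, hε₀, hε⟩ := hhor η hη
    obtain ⟨e, he0, he⟩ : ∃ e, 0 < e ∧ e < min ε₀ (min x.2 y.2) :=
      exists_between (lt_min hε₀ (lt_min hx0 hy0))
    have he1 : e < ε₀ := he.trans_le (min_le_left _ _)
    have he2 : e < x.2 := he.trans_le ((min_le_right _ _).trans (min_le_left _ _))
    have he3 : e < y.2 := he.trans_le ((min_le_right _ _).trans (min_le_right _ _))
    have h1 := hvert x.1 e x.2 hx'.1 he0 he2.le hx'.2.2
    have h2 := hvert y.1 e y.2 hy'.1 he0 he3.le hy'.2.2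
    have h3 := hε e he0 he1 (he2.le.trans hx'.2.2) x.1 y.1 hx'.1 hy'.1
    have h4 := mul_nonneg hM0 he0.le
    simp only [Prod.mk.eta] at h1 h2
    rw [abs_le] at h1 h2 h3 ⊢
    constructor <;> linarith
  -- By `hkey` every `q x - M * x.2` is at most every `q y + M * y.2`; the supremum of the former
  -- separates the two families and is the boundary value.
  let T : Set ℝ := {a | ∃ x ∈ Q, 0 < x.2 ∧ a = q x - M * x.2}
  let x₁ : ℝ × ℝ := (t₀, δ)
  have hx₁ : x₁ ∈ Q := (hQ_mem _).2 ⟨by simp [x₁, hδ0.le], hδ0.le, le_rfl⟩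
  have hbddA : ∀ y ∈ Q, 0 < y.2 → ∀ a ∈ T,
      a ≤ q y + M * y.2 := by
    rintro y hy hy0 _ ⟨x, hx, hx0, rfl⟩
    have := (abs_le.1 (hkey x hx hx0 y hy hy0)).2
    linarith
  have hK : ∀ x ∈ Q, 0 < x.2 →
      |q x - sSup T| ≤ M * x.2 := by
    intro x hx hx0
    have h1 := le_csSup (⟨_, hbddA x hx hx0⟩ : BddAbove T) ⟨x, hx, hx0, rfl⟩
    have h2 := csSup_le (⟨_, x, hx, hx0, rfl⟩ : T.Nonempty) (hbddA x hx hx0)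
    rw [abs_le]
    constructor <;> linarith
  refine ⟨sSup T, ?_⟩
  have hev : ∀ᶠ t in 𝓝 t₀, boundaryChart β t₀ '' Metric.ball (t₀, 0) δ ∈ 𝓝 (β t) :=
    (hβ.hasDerivAt t₀).continuousAt.eventually (eventually_mem_nhds_iff.2 hnhds)
  filter_upwards [hev, Metric.ball_mem_nhds t₀ hδ0] with t ht htδ
  rw [tendsto_iff_dist_tendsto_zero]
  have hlim : Tendsto (fun z => M * (2 * ‖z - β t‖)) (𝓝[Ω] (β t)) (𝓝 0) := by
    have : Continuous (fun z => M * (2 * ‖z - β t‖)) := by fun_prop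
    have h0 := this.tendsto (β t)
    simp only [sub_self, norm_zero, mul_zero] at h0
    exact h0.mono_left nhdsWithin_le_nhds
  refine squeeze_zero' (Eventually.of_forall fun z => dist_nonneg) ?_ hlim
  filter_upwards [mem_nhdsWithin_of_mem_nhds ht, self_mem_nhdsWithin] with z hz hzΩ
  obtain ⟨x, hx, rfl⟩ := hz
  have hx0 : 0 < x.2 := (hΩiff x (Metric.ball_subset_ball hδδ₂.le hx)).1 hzΩ
  have hxQ : x ∈ Q := ⟨Metric.ball_subset_closedBall hx, hx0.le⟩
  have htb : ((t, 0) : ℝ × ℝ) ∈ Metric.ball (t₀, 0) δ :=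
    mem_ball_prod_iff.2 ⟨by simpa [Real.dist_eq] using htδ, by simpa using hδ0⟩
  have h1 := norm_sub_le_two_mul hτ (happ x hx (t, 0) htb)
  rw [boundaryChart_zero] at h1
  have h2 : x.2 ≤ ‖x - (t, 0)‖ := by
    have := norm_snd_le (x - (t, 0))
    simp only [Prod.snd_sub, sub_zero] at this
    exact (le_abs_self _).trans this
  rw [Real.dist_eq]
  exact (hK x hxQ hx0).trans (mul_le_mul_of_nonneg_left (h2.trans h1) hM0)

/-- Near a simple boundary pole with purely imaginary residue of `h`, the real part of a primitive
of `h` is `o(log)`. -/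
theorem eventually_abs_re_le_sub_log (hβ : IsSmoothBoundaryParam Ω β L) (hopen : IsOpen Ω)
    {F h : ℂ → ℂ} (hF : ∀ z ∈ Ω, HasDerivAt F (h z) z) {t₀ : ℝ} {A : ℂ} (hA : A.re = 0)
    (hlim : Tendsto (fun z => h z * (z - β t₀)) (𝓝[Ω] (β t₀)) (𝓝 A)) {η : ℝ} (hη : 0 < η) :
    ∃ C : ℝ, ∀ᶠ z in 𝓝[Ω] (β t₀), |(F z).re| ≤ C - η * Real.log ‖z - β t₀‖ := by
  have hcont := hβ.continuous_boundaryChart t₀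
  have hp : boundaryChart β t₀ (t₀, 0) = β t₀ := boundaryChart_zero t₀ t₀
  have hτ := hβ.unit_speed t₀
  have hτ0 : deriv β t₀ ≠ 0 := by intro h0; rw [h0] at hτ; simp at hτ
  set ν : ℂ := Complex.I * deriv β t₀ with hν
  have hν1 : ‖ν‖ = 1 := norm_I_mul_of_norm_one hτ
  have hν0 : ν ≠ 0 := by intro h0; rw [h0] at hν1; simp at hν1
  set p : ℂ := β t₀ with hpdef
  -- The 4 compensates the lower bound `(s + e) / 4` for the distance to the pole, found below.
  set η₁ : ℝ := η / 4 with hη₁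
  have hη₁0 : 0 < η₁ := by positivity
  have hev : ∀ᶠ z in 𝓝[Ω] p, ‖h z * (z - p) - A‖ < η₁ := by
    have := hlim.eventually (Metric.ball_mem_nhds A hη₁0)
    simpa [dist_eq_norm] using this
  rw [eventually_nhdsWithin_iff] at hev
  have hev' : ∀ᶠ x in 𝓝 ((t₀, 0) : ℝ × ℝ), boundaryChart β t₀ x ∈ Ω →
      ‖h (boundaryChart β t₀ x) * (boundaryChart β t₀ x - p) - A‖ < η₁ :=
    hcont.continuousAt.eventually (by rw [hp]; exact hev)
  obtain ⟨δS, hδS, hSev⟩ := Metric.eventually_nhds_iff_ball.1 hev'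
  obtain ⟨δ₁, hδ₁, hδ₁'⟩ := (nhdsGT_basis (0 : ℝ)).eventually_iff.1
    (hβ.eventually_boundaryChart hopen t₀)
  obtain ⟨δ, hδ0, hδ⟩ : ∃ δ, 0 < δ ∧ δ < min 1 (min δS δ₁) :=
    exists_between (by positivity)
  have hδ2 : δ < 1 := hδ.trans_le (min_le_left _ _)
  have hδS' : δ < δS := hδ.trans_le ((min_le_right _ _).trans (min_le_left _ _))
  have hδδ₁ : δ < δ₁ := hδ.trans_le ((min_le_right _ _).trans (min_le_right _ _))
  obtain ⟨-, happ, hΩiff⟩ := hδ₁' ⟨hδ0, hδδ₁⟩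
  have hnhds := (hδ₁' ⟨half_pos hδ0, (half_lt_self hδ0).trans hδδ₁⟩).1
  have hx₀ : ((t₀, 0) : ℝ × ℝ) ∈ Metric.ball (t₀, 0) δ := Metric.mem_ball_self hδ0
  -- Relative to the inner normal `ν`, a point with `x.1 ≠ t₀` has nonzero imaginary part, since the
  -- chart error is at most a quarter of `|x.1 - t₀|`; on the normal line itself the quotient is
  -- positive. So the principal logarithm is holomorphic on the half box.
  have hslit : ∀ x ∈ Metric.ball ((t₀, 0) : ℝ × ℝ) δ, 0 < x.2 →
      (boundaryChart β t₀ x - p) / ν ∈ Complex.slitPlane := by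
    intro x hx hx0
    have hx' := mem_ball_prod_iff.1 hx
    have hxb : ((x.1, 0) : ℝ × ℝ) ∈ Metric.ball (t₀, 0) δ :=
      mem_ball_prod_iff.2 ⟨hx'.1, by simpa using hδ0⟩
    have h1 := happ _ hxb _ hx₀
    simp only [boundaryChart_zero, chartDeriv_apply] at h1
    have hn : ‖((x.1, 0) : ℝ × ℝ) - (t₀, 0)‖ = |x.1 - t₀| := by
      simp [Prod.norm_def]
    rw [hn] at h1
    set err : ℂ := β x.1 - p - ((x.1 - t₀ : ℝ) : ℂ) * deriv β t₀ with herr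
    have h2 : ‖err‖ ≤ 1 / 4 * |x.1 - t₀| := by simpa [herr] using h1
    have h3 : (boundaryChart β t₀ x - p) / ν =
        (x.2 : ℂ) + -((x.1 - t₀ : ℝ) : ℂ) * Complex.I + err / ν := by
      rw [div_eq_iff hν0, add_mul, div_mul_cancel₀ _ hν0, herr, boundaryChart, ← hν]
      have : -((x.1 - t₀ : ℝ) : ℂ) * Complex.I * ν = ((x.1 - t₀ : ℝ) : ℂ) * deriv β t₀ := by
        rw [hν]; linear_combination -((x.1 - t₀ : ℝ) : ℂ) * deriv β t₀ * Complex.I_mul_I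
      rw [add_mul, this]; ring
    have h4 : ‖err / ν‖ ≤ 1 / 4 * |x.1 - t₀| := by rw [norm_div, hν1, div_one]; exact h2
    have him : ((boundaryChart β t₀ x - p) / ν).im = -(x.1 - t₀) + (err / ν).im := by
      rw [h3]; simp
    have hre : ((boundaryChart β t₀ x - p) / ν).re = x.2 + (err / ν).re := by
      rw [h3]; simp
    by_cases hs : x.1 - t₀ = 0
    · left
      rw [hre]
      rw [hs, abs_zero, mul_zero] at h4
      have := (norm_le_zero_iff.1 h4)
      rw [this]
      simpa using hx0
    · right
      rw [him]
      have h5 := (Complex.abs_im_le_norm (err / ν)).trans h4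
      have h6 : 0 < |x.1 - t₀| := abs_pos.2 hs
      intro h0
      have : (err / ν).im = x.1 - t₀ := by linarith
      rw [this] at h5
      linarith
  -- Removing the pole term leaves a derivative that is `o(1 / |z - p|)`. Since `A` is imaginary,
  -- the real parts of `F` and `G` differ only by `A.im` times an argument, at most `‖A‖ π`.
  let G : ℂ → ℂ := fun z => F z - A * Complex.log ((z - p) / ν)
  have hG : ∀ x ∈ Metric.ball ((t₀, 0) : ℝ × ℝ) δ, 0 < x.2 →
      HasDerivAt G (h (boundaryChart β t₀ x) - A / (boundaryChart β t₀ x - p))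
        (boundaryChart β t₀ x) := by
    intro x hx hx0
    have h1 := hF _ ((hΩiff x hx).2 hx0)
    have hsl := hslit x hx hx0
    have h2 : HasDerivAt (fun z => (z - p) / ν) (1 / ν) (boundaryChart β t₀ x) :=
      ((hasDerivAt_id _).sub_const p).div_const ν
    have h3 := (h2.clog hsl).const_mul A
    have h4 := h1.sub h3
    have hne : boundaryChart β t₀ x - p ≠ 0 := by
      intro h0
      rw [h0, zero_div] at hsl
      exact Complex.slitPlane_ne_zero hsl rfl
    have e : A / (boundaryChart β t₀ x - p) =
        A * (1 / ν / ((boundaryChart β t₀ x - p) / ν)) := by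
      field_simp
    rw [e]
    exact h4
  have hGF : ∀ x, |(F (boundaryChart β t₀ x)).re| ≤
      |(G (boundaryChart β t₀ x)).re| + ‖A‖ * Real.pi ∧
      |(G (boundaryChart β t₀ x)).re| ≤ |(F (boundaryChart β t₀ x)).re| + ‖A‖ * Real.pi := by
    intro x
    have h1 : (G (boundaryChart β t₀ x)).re = (F (boundaryChart β t₀ x)).re +
        A.im * Complex.arg ((boundaryChart β t₀ x - p) / ν) := by
      simp [G, Complex.sub_re, Complex.mul_re, hA, Complex.log_im]
    have h2 : |A.im * Complex.arg ((boundaryChart β t₀ x - p) / ν)| ≤ ‖A‖ * Real.pi := by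
      rw [abs_mul]
      exact mul_le_mul (Complex.abs_im_le_norm A) (Complex.abs_arg_le_pi _) (abs_nonneg _)
        (norm_nonneg _)
    rw [h1]
    rw [abs_le] at h2
    constructor
    · rw [abs_le]
      have h3 := neg_abs_le ((F (boundaryChart β t₀ x)).re +
        A.im * Complex.arg ((boundaryChart β t₀ x - p) / ν))
      have h4 := le_abs_self ((F (boundaryChart β t₀ x)).re +
        A.im * Complex.arg ((boundaryChart β t₀ x - p) / ν))
      constructor <;> linarith
    · rw [abs_le]
      have h3 := neg_abs_le (F (boundaryChart β t₀ x)).re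
      have h4 := le_abs_self (F (boundaryChart β t₀ x)).re
      constructor <;> linarith
  have hδh : δ / 2 < δ := half_lt_self hδ0
  have htop : ∃ C₁, ∀ t ∈ Icc (t₀ - δ / 2) (t₀ + δ / 2),
      ‖(F (boundaryChart β t₀ (t, δ / 2))).re‖ ≤ C₁ := by
    refine isCompact_Icc.exists_bound_of_continuousOn ?_
    refine Complex.continuous_re.comp_continuousOn ?_
    have hFc : ContinuousOn F Ω := fun z hz => (hF z hz).continuousAt.continuousWithinAt
    refine hFc.comp (hcont.comp (by fun_prop : Continuous fun t : ℝ => (t, δ / 2))).continuousOn ?_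
    intro t ht
    refine (hΩiff _ (mem_ball_prod_iff.2 ⟨?_, ?_⟩)).2 (half_pos hδ0)
    · exact (abs_le.2 ⟨by linarith [ht.1], by linarith [ht.2]⟩).trans_lt hδh
    · exact (abs_of_pos (half_pos hδ0)).trans_lt hδh
  obtain ⟨C₁, hC₁⟩ := htop
  -- `C₁` bounds `Re F` at height `δ / 2`, the two terms `‖A‖ π` pay for passing to `G` and back,
  -- and `log 3` comes from the upper Lipschitz constant of the chart.
  refine ⟨C₁ + 2 * (‖A‖ * Real.pi) + η * Real.log 3, ?_⟩
  filter_upwards [mem_nhdsWithin_of_mem_nhds hnhds, self_mem_nhdsWithin] with z hz hzΩ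
  obtain ⟨x, hx, rfl⟩ := hz
  have hxδ := Metric.ball_subset_ball hδh.le hx
  have hx0 : 0 < x.2 := (hΩiff x hxδ).1 hzΩ
  have hx' := mem_ball_prod_iff.1 hx
  rw [abs_of_pos hx0] at hx'
  set s : ℝ := |x.1 - t₀| with hs
  have hs0 : 0 ≤ s := abs_nonneg _
  have hmem : ∀ e ∈ Icc x.2 (δ / 2), ((x.1, e) : ℝ × ℝ) ∈ Metric.ball (t₀, 0) δ := by
    intro e he
    refine mem_ball_prod_iff.2 ⟨hx'.1.trans hδh, ?_⟩
    rw [abs_of_pos (hx0.trans_le he.1)]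
    exact he.2.trans_lt hδh
  -- Integrate `G'`, bounded by `η / (s + e)`, along the vertical segment up to height `δ / 2`.
  have hmain := norm_sub_le_of_hasDerivAt (f := fun e => (G (boundaryChart β t₀ (x.1, e))).re)
    (B := fun e => η * Real.log (s + e)) (B' := fun e => η * (1 / (s + e))) hx'.2.le
    (fun e he => hasDerivAt_re_comp (hG _ (hmem e he) (hx0.trans_le he.1))
      (hasDerivAt_boundaryChart_snd β t₀ x.1 e))
    (fun e he => (((hasDerivAt_id e).const_add s).log
      (by have := hx0.trans_le he.1; simp only [id]; positivity)).const_mul η)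
    (fun e he => by
      have he0 : 0 < e := hx0.trans_le he.1
      have hxe := hmem e he
      refine (Complex.abs_re_le_norm _).trans ?_
      rw [norm_mul, ← hν, hν1, mul_one]
      have h1 := norm_sub_le_two_mul hτ (happ _ hxe _ hx₀)
      rw [hp] at h1
      have h2 : (s + e) / 2 ≤ ‖((x.1, e) : ℝ × ℝ) - (t₀, 0)‖ := by
        have a1 := norm_fst_le (((x.1, e) : ℝ × ℝ) - (t₀, 0))
        have a2 := norm_snd_le (((x.1, e) : ℝ × ℝ) - (t₀, 0))
        simp only [Prod.fst_sub, Prod.snd_sub, sub_zero, Real.norm_eq_abs] at a1 a2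
        rw [abs_of_pos he0] at a2
        linarith
      have h3 : (s + e) / 4 ≤ ‖boundaryChart β t₀ (x.1, e) - p‖ := by linarith
      have h4 : 0 < ‖boundaryChart β t₀ (x.1, e) - p‖ := by
        have : 0 < (s + e) / 4 := by positivity
        linarith
      have h5 := hSev _ (Metric.ball_subset_ball hδS'.le hxe) ((hΩiff _ hxe).2 he0)
      have h6 : h (boundaryChart β t₀ (x.1, e)) - A / (boundaryChart β t₀ (x.1, e) - p) =
          (h (boundaryChart β t₀ (x.1, e)) * (boundaryChart β t₀ (x.1, e) - p) - A) /
            (boundaryChart β t₀ (x.1, e) - p) := by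
        have := norm_pos_iff.1 h4
        field_simp
      rw [h6, norm_div, div_le_iff₀ h4]
      refine h5.le.trans ?_
      rw [mul_one_div, div_mul_eq_mul_div, le_div_iff₀ (by positivity), hη₁]
      nlinarith)
  have hlog1 : Real.log (s + δ / 2) ≤ 0 := Real.log_nonpos (by positivity) (by linarith [hx'.1])
  have hz0 : 0 < ‖boundaryChart β t₀ x - p‖ := by
    rw [norm_pos_iff]
    intro h0
    have := Complex.slitPlane_ne_zero (hslit x hxδ hx0)
    rw [h0, zero_div] at this
    exact this rfl
  have hlog2 : Real.log ‖boundaryChart β t₀ x - p‖ ≤ Real.log 3 + Real.log (s + x.2) := by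
    rw [← Real.log_mul (by norm_num) (by positivity)]
    refine Real.log_le_log hz0 ?_
    have h1 := norm_map_sub_le_three_mul hτ (happ x hxδ _ hx₀)
    rw [hp] at h1
    have h2 : ‖x - (t₀, 0)‖ ≤ s + x.2 := by
      refine max_le ?_ ?_
      · simp only [Prod.fst_sub, Real.norm_eq_abs]; linarith
      · simp only [Prod.snd_sub, sub_zero, Real.norm_eq_abs, abs_of_pos hx0]; linarith
    linarith
  have hC := hC₁ x.1 (by
    have := abs_le.1 hx'.1.le
    exact ⟨by linarith, by linarith⟩)
  rw [Real.norm_eq_abs] at hC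
  have h1 := (hGF x).1
  have h2 := (hGF (x.1, δ / 2)).2
  have h3 := abs_sub_abs_le_abs_sub (G (boundaryChart β t₀ x)).re
    (G (boundaryChart β t₀ (x.1, δ / 2))).re
  simp only [Prod.mk.eta] at hmain
  rw [abs_sub_comm] at hmain
  have h4 := mul_le_mul_of_nonneg_left hlog1 hη.le
  have h5 := mul_le_mul_of_nonneg_left hlog2 hη.le
  rw [mul_zero] at h4
  rw [mul_add] at h5
  linarith

end IsSmoothBoundaryParam

end Hedgehog

/-! ### Paths into the domain and integrals along them -/

namespace Hedgehog

variable {Ω : Set ℂ}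

theorem contDiffOn_extend_segment (a b : ℂ) (n : WithTop ℕ∞) :
    ContDiffOn ℝ n (Path.segment a b).extend (Icc 0 1) :=
  ((contDiff_const.add (contDiff_id.smul contDiff_const) :
    ContDiff ℝ n fun t : ℝ => a + t • (b - a)).contDiffOn).congr fun t ht => by
      rw [Path.eqOn_extend_segment a b ht, AffineMap.lineMap_apply]
      simp [add_comm]

theorem isPathInto_segment {a b : ℂ}
    (h : ∀ t : ℝ, 0 < t → t ≤ 1 → AffineMap.lineMap a b t ∈ Ω) :
    IsPathInto Ω (Path.segment a b) := by
  refine ⟨fun t ht => ?_, 1, fun i => min (i : ℝ) 1, ?_, by simp, by simp, ?_⟩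
  · have := h t ht t.2.2
    rw [← Path.eqOn_extend_segment a b t.2, Path.extend_apply _ t.2] at this
    exact this
  · intro i j hij
    exact min_le_min_right _ (by exact_mod_cast hij)
  · intro i hi
    obtain rfl : i = 0 := by omega
    simpa using contDiffOn_extend_segment a b 1

theorem IsPathInto.trans_segment {p q r : ℂ} {γ : Path p q} (hγ : IsPathInto Ω γ)
    (hqr : ∀ t ∈ Icc (0 : ℝ) 1, AffineMap.lineMap q r t ∈ Ω) :
    IsPathInto Ω (γ.trans (Path.segment q r)) := by
  obtain ⟨hpos, N, τ, hmono, h0, h1, hC⟩ := hγ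
  have hle1 : ∀ i ≤ N, τ i ≤ 1 := fun i hi => h1 ▸ hmono hi
  -- The old breakpoints are halved, ending at `τ N / 2 = 1 / 2`; the segment occupies the
  -- additional piece up to 1.
  refine ⟨fun t ht => ?_, N + 1, fun i => if i ≤ N then τ i / 2 else 1, ?_, by simp [h0], by simp,
    ?_⟩
  · have ht' : (0 : ℝ) < t := ht
    rw [← Path.extend_apply _ t.2]
    rcases le_total (t : ℝ) (1 / 2) with h | h
    · rw [Path.extend_trans_of_le_half _ _ h,
        Path.extend_apply _ ⟨by linarith, by linarith⟩]
      exact hpos _ (show (0 : ℝ) < 2 * t by linarith)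
    · rw [Path.extend_trans_of_half_le _ _ h]
      have hm : 2 * (t : ℝ) - 1 ∈ Icc (0 : ℝ) 1 := ⟨by linarith, by linarith [t.2.2]⟩
      rw [Path.eqOn_extend_segment q r hm]
      exact hqr _ hm
  · refine monotone_nat_of_le_succ fun i => ?_
    by_cases hi : i + 1 ≤ N
    · have hi' : i ≤ N := by omega
      simp only [hi, hi', if_true]
      linarith [hmono (Nat.le_succ i)]
    · by_cases hi' : i ≤ N
      · simp only [hi, hi', if_true, if_false]
        linarith [hle1 i hi']
      · simp only [hi, hi', if_false, le_refl]
  · intro i hi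
    by_cases hiN : i + 1 ≤ N
    · have hi' : i ≤ N := by omega
      simp only [hiN, hi', if_true]
      have hc := (hC i (by omega)).comp
        (contDiff_const.mul contDiff_id : ContDiff ℝ 1 fun t : ℝ => 2 * t).contDiffOn
        (s := Icc (τ i / 2) (τ (i + 1) / 2))
        (fun t ht => ⟨by linarith [ht.1], by linarith [ht.2]⟩)
      refine hc.congr fun t ht => ?_
      exact Path.extend_trans_of_le_half _ _ (by linarith [ht.2, hle1 _ hiN])
    · have hi' : i = N := by omega
      subst hi'
      simp only [hiN, le_refl, if_true, if_false, h1]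
      have hc := (contDiffOn_extend_segment q r 1).comp
        ((contDiff_const.mul contDiff_fun_id).sub contDiff_const :
          ContDiff ℝ 1 fun t : ℝ => 2 * t - 1).contDiffOn
        (s := Icc (1 / 2 : ℝ) 1)
        (fun t ht => ⟨by linarith [ht.1], by linarith [ht.2]⟩)
      refine hc.congr fun t ht => ?_
      exact Path.extend_trans_of_half_le _ _ ht.1

/-- The endpoints of such paths form an open and relatively closed subset of `Ω`, since a segment
inside a ball can be appended. -/
theorem IsPathInto.exists_of_isPreconnected {p q w : ℂ} (hopen : IsOpen Ω)
    (hconn : IsPreconnected Ω) {γ : Path p q} (hγ : IsPathInto Ω γ) (hw : w ∈ Ω) :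
    ∃ γ' : Path p w, IsPathInto Ω γ' := by
  have hmem : ∀ {r : ℂ} (γ : Path p r), IsPathInto Ω γ → r ∈ Ω := fun γ hγ => by
    simpa using hγ.1 1 one_pos
  have hball : ∀ {r r' : ℂ} {ρ : ℝ} (c : ℂ), Metric.ball c ρ ⊆ Ω → r ∈ Metric.ball c ρ →
      r' ∈ Metric.ball c ρ → (∃ γ : Path p r, IsPathInto Ω γ) →
      ∃ γ : Path p r', IsPathInto Ω γ := by
    rintro r r' ρ c hsub hr hr' ⟨γ, hγ⟩
    refine ⟨_, hγ.trans_segment (r := r') fun t ht => hsub ?_⟩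
    exact (convex_ball c ρ).segment_subset hr hr' (lineMap_mem_segment ℝ r r' ht)
  suffices Ω ⊆ {r | ∃ γ : Path p r, IsPathInto Ω γ} from this hw
  refine hconn.subset_of_closure_inter_subset ?_ ⟨q, hmem γ hγ, γ, hγ⟩ ?_
  · rw [Metric.isOpen_iff]
    rintro r ⟨γ', hγ'⟩
    obtain ⟨ρ, hρ, hsub⟩ := Metric.isOpen_iff.1 hopen r (hmem γ' hγ')
    exact ⟨ρ, hρ, fun r' hr' => hball r hsub (Metric.mem_ball_self hρ) hr' ⟨γ', hγ'⟩⟩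
  · rintro r ⟨hr, hrΩ⟩
    obtain ⟨ρ, hρ, hsub⟩ := Metric.isOpen_iff.1 hopen r hrΩ
    obtain ⟨r', hr', hdist⟩ := Metric.mem_closure_iff.1 hr ρ hρ
    exact hball r hsub (by rwa [Metric.mem_ball, dist_comm]) (Metric.mem_ball_self hρ) hr'

theorem reForm_apply (h : ℂ → ℂ) (z v : ℂ) : reForm h z v = (h z * v).re := rfl

/-- The integral of `Re [h(z) dz]` along a path into `Ω` is the increment of the real part of a
primitive of `h`. -/
theorem IsPathInto.curveIntegral_reForm {p w : ℂ} {γ : Path p w} (hγ : IsPathInto Ω γ)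
    {F h : ℂ → ℂ} (hF : ∀ z ∈ Ω, HasDerivAt F (h z) z) (hh : ContinuousOn h (insert p Ω)) {K : ℝ}
    (hlim : Tendsto (fun z => (F z).re) (𝓝[Ω] p) (𝓝 K)) :
    CurveIntegrable (reForm h) γ ∧ curveIntegral (reForm h) γ = (F w).re - K := by
  obtain ⟨hpos, N, τ, hmono, h0, h1, hC⟩ := hγ
  have hposE : ∀ t ∈ Ioc (0 : ℝ) 1, γ.extend t ∈ Ω := fun t ht => by
    rw [Path.extend_apply _ ⟨ht.1.le, ht.2⟩]
    exact hpos _ ht.1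
  have hle1 : ∀ i ≤ N, τ i ≤ 1 := fun i hi => h1 ▸ hmono hi
  have hge0 : ∀ i, 0 ≤ τ i := fun i => h0 ▸ hmono (Nat.zero_le i)
  have hmaps : MapsTo γ.extend (Icc 0 1) (insert p Ω) := by
    intro t ht
    rcases ht.1.eq_or_lt with h | h
    · left; rw [← h]; simp
    · right; exact hposE t ⟨h, ht.2⟩
  have hhγ : ContinuousOn (fun t => h (γ.extend t)) (Icc 0 1) :=
    hh.comp γ.continuous_extend.continuousOn hmaps
  have hfun : ∀ t, curveIntegralFun (reForm h) γ t =
      (h (γ.extend t) * derivWithin γ.extend (Icc 0 1) t).re := by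
    intro t
    rw [curveIntegralFun_def, reForm_apply]
  have hsubI : ∀ i < N, Icc (τ i) (τ (i + 1)) ⊆ Icc 0 1 := fun i hi =>
    Icc_subset_Icc (hge0 i) (hle1 _ hi)
  have hint : CurveIntegrable (reForm h) γ := by
    unfold CurveIntegrable
    rw [← h0, ← h1]
    refine IntervalIntegrable.trans_iterate fun i hi => ?_
    rcases (hmono (Nat.le_succ i)).eq_or_lt with heq | hlt
    · rw [← heq]
    -- Inside a piece the derivative within `[0, 1]` agrees with the derivative within the piece,
    -- which is continuous up to the endpoints.
    · have hc : ContinuousOn (fun t => (h (γ.extend t) *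
          derivWithin γ.extend (Icc (τ i) (τ (i + 1))) t).re) (Icc (τ i) (τ (i + 1))) :=
        Complex.continuous_re.comp_continuousOn ((hhγ.mono (hsubI i hi)).mul
          ((hC i hi).continuousOn_derivWithin (uniqueDiffOn_Icc hlt) le_rfl))
      refine (hc.intervalIntegrable_of_Icc hlt.le).congr_ae ?_
      rw [uIoc_of_le hlt.le, ← restrict_Ioo_eq_restrict_Ioc]
      filter_upwards [ae_restrict_mem measurableSet_Ioo] with t ht
      rw [hfun, derivWithin_of_mem_nhds (Icc_mem_nhds ht.1 ht.2),
        derivWithin_of_mem_nhds (mem_of_superset (Icc_mem_nhds ht.1 ht.2) (hsubI i hi))]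
  refine ⟨hint, ?_⟩
  have hdiff : ∀ t ∈ Ioo (0 : ℝ) 1 \ range τ, DifferentiableAt ℝ γ.extend t := by
    rintro t ⟨ht, htτ⟩
    have hex : ∃ j, t < τ j := ⟨N, h1 ▸ ht.2⟩
    classical
    obtain ⟨i, hi⟩ : ∃ i, Nat.find hex = i + 1 := Nat.exists_eq_succ_of_ne_zero fun h => by
      have := Nat.find_spec hex
      rw [h, h0] at this
      exact absurd this (not_lt.2 ht.1.le)
    have hi1 : t < τ (i + 1) := hi ▸ Nat.find_spec hex
    have hi2 : τ i < t := lt_of_le_of_ne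
      (not_lt.1 (Nat.find_min hex (by omega))) fun h => htτ ⟨i, h⟩
    have hiN : i < N := by
      have := Nat.find_min' hex (show t < τ N from h1 ▸ ht.2)
      omega
    exact ((hC i hiN).contDiffAt (Icc_mem_nhds hi2 hi1)).differentiableAt (by simp)
  -- The value of `F` at the boundary point `p` is arbitrary, so `Re F ∘ γ` is redefined at time 0
  -- as the limit `K`. The breakpoints form the countable exceptional set.
  have hQ := integral_eq_of_hasDerivAt_off_countable_of_le
    (Function.update (fun t => (F (γ.extend t)).re) 0 K) (curveIntegralFun (reForm h) γ)
    zero_le_one (countable_range τ) (by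
      intro t ht
      rcases ht.1.eq_or_lt with h | h
      · subst h
        rw [continuousWithinAt_update_same]
        refine hlim.comp (tendsto_nhdsWithin_iff.2 ⟨?_, ?_⟩)
        · have := γ.continuous_extend.tendsto 0
          rw [Path.extend_zero] at this
          exact this.mono_left nhdsWithin_le_nhds
        · filter_upwards [self_mem_nhdsWithin] with s hs
          exact hposE s ⟨lt_of_le_of_ne hs.1.1 (Ne.symm hs.2), hs.1.2⟩
      · rw [continuousWithinAt_update_of_ne h.ne']
        exact (Complex.continuous_re.continuousAt.comp
          ((hF _ (hposE t ⟨h, ht.2⟩)).continuousAt.comp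
            γ.continuous_extend.continuousAt)).continuousWithinAt)
    (by
      rintro t ht
      have hd := (hdiff t ht).hasDerivAt
      have := hasDerivAt_re_comp (hF _ (hposE t ⟨ht.1.1, ht.1.2.le⟩)) hd
      rw [hfun, derivWithin_of_mem_nhds (Icc_mem_nhds ht.1.1 ht.1.2)]
      refine this.congr_of_eventuallyEq ?_
      filter_upwards [lt_mem_nhds ht.1.1] with s hs
      rw [Function.update_of_ne hs.ne'])
    hint
  rw [curveIntegral_def, hQ]
  simp

end Hedgehog

/-! ### The boundary value problem and identification with harmonic measure -/

namespace Hedgehog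

variable {Ω : Set ℂ} {β : ℝ → ℂ} {L : ℝ}

theorem IsBoundaryPoleSolution.re_mul_mul_deriv_eq_zero {f g : ℂ → ℂ} {u v : ℂ}
    (hf : IsBoundaryPoleSolution Ω β v f) (hg : IsBoundaryPoleSolution Ω β u g) {t : ℝ}
    (hu : β t ≠ u) (hv : β t ≠ v) : (f (β t) * g (β t) * deriv β t).re = 0 := by
  obtain ⟨σ, hσ⟩ := IsAlgClosed.exists_pow_nat_eq (outerNormal β t) two_pos
  have h1 := hf.boundary t σ hv hσ
  have h2 := hg.boundary t σ hu hσ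
  have h3 : (f (β t) * σ * (g (β t) * σ)).im = 0 := by rw [Complex.mul_im, h1, h2]; ring
  have h4 : f (β t) * σ * (g (β t) * σ) = -Complex.I * (f (β t) * g (β t) * deriv β t) := by
    have : f (β t) * σ * (g (β t) * σ) = f (β t) * g (β t) * σ ^ 2 := by ring
    rw [this, hσ, outerNormal]; ring
  rw [h4, neg_mul, Complex.neg_im, Complex.I_mul_im] at h3
  exact neg_eq_zero.1 h3

namespace IsSmoothBoundaryParam

theorem neBot_nhdsWithin (hβ : IsSmoothBoundaryParam Ω β L) (t : ℝ) : (𝓝[Ω] (β t)).NeBot :=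
  mem_closure_iff_nhdsWithin_neBot.1 (hβ.mem_frontier t).1

theorem notMem (hβ : IsSmoothBoundaryParam Ω β L) (hopen : IsOpen Ω) (t : ℝ) : β t ∉ Ω := by
  have := (hβ.mem_frontier t).2
  rwa [hopen.interior_eq] at this

theorem tendsto_mul_sub_of_pole (hβ : IsSmoothBoundaryParam Ω β L) (hopen : IsOpen Ω) {g : ℂ → ℂ}
    {t : ℝ} {σ : ℂ} (hO : (fun z => g z - 1 / (2 * (Real.pi : ℂ)) * (Complex.I * σ / (z - β t)))
      =O[𝓝[Ω] (β t)] (fun _ => (1 : ℝ))) :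
    Tendsto (fun z => g z * (z - β t)) (𝓝[Ω] (β t))
      (𝓝 (1 / (2 * (Real.pi : ℂ)) * (Complex.I * σ))) := by
  have h0 : Tendsto (fun z => ‖z - β t‖) (𝓝[Ω] (β t)) (𝓝 0) := by
    have : Continuous fun z : ℂ => ‖z - β t‖ := by fun_prop
    have h := this.tendsto (β t)
    simp only [sub_self, norm_zero] at h
    exact h.mono_left nhdsWithin_le_nhds
  have h1 := hO.mul (Asymptotics.isBigO_refl (fun z => z - β t) (𝓝[Ω] (β t))).norm_right
  simp only [one_mul] at h1
  have h2 := h1.trans_tendsto h0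
  have h3 := h2.add_const (1 / (2 * (Real.pi : ℂ)) * (Complex.I * σ))
  rw [zero_add] at h3
  refine h3.congr' ?_
  filter_upwards [self_mem_nhdsWithin] with z hz
  have hne : z - β t ≠ 0 := sub_ne_zero.2 fun h => hβ.notMem hopen t (h ▸ hz)
  field_simp
  ring

/-- The residue of the product at `u` is `f(u) · iσ / 2π`, and the boundary condition for `f` at
`u`, with the same root `σ` as in the pole of `g`, says that `f(u) σ` is real. -/
theorem exists_tendsto_mul_mul_sub (hβ : IsSmoothBoundaryParam Ω β L) (hopen : IsOpen Ω)
    {f g : ℂ → ℂ} {u v : ℂ} (hf : IsBoundaryPoleSolution Ω β v f)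
    (hg : IsBoundaryPoleSolution Ω β u g) (huv : u ≠ v) :
    ∃ (t : ℝ) (A : ℂ), β t = u ∧ A.re = 0 ∧
      Tendsto (fun z => f z * g z * (z - β t)) (𝓝[Ω] (β t)) (𝓝 A) := by
  obtain ⟨t, σ, rfl, hσ, hO⟩ := hg.pole
  refine ⟨t, f (β t) * (1 / (2 * (Real.pi : ℂ)) * (Complex.I * σ)), rfl, ?_, ?_⟩
  · have h1 := hf.boundary t σ huv hσ
    have h2 : f (β t) * (1 / (2 * (Real.pi : ℂ)) * (Complex.I * σ)) =
        ((1 / (2 * Real.pi) : ℝ) : ℂ) * (Complex.I * (f (β t) * σ)) := by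
      push_cast; ring
    rw [h2, Complex.re_ofReal_mul, Complex.I_mul_re, h1]
    simp
  · have hfc : Tendsto f (𝓝[Ω] (β t)) (𝓝 (f (β t))) := by
      have h1 : ContinuousWithinAt f (closure Ω \ {v}) (β t) :=
        hf.continuousOn _ ⟨(hβ.mem_frontier t).1, huv⟩
      refine h1.mono_left ?_
      rw [nhdsWithin_le_iff]
      filter_upwards [self_mem_nhdsWithin, mem_nhdsWithin_of_mem_nhds
        (isOpen_compl_singleton.mem_nhds (show β t ∈ ({v} : Set ℂ)ᶜ from huv))] with z hz hz'
      exact ⟨subset_closure hz, hz'⟩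
    exact (hfc.mul (hβ.tendsto_mul_sub_of_pole hopen hO)).congr fun z => by ring

/-- The solution of the boundary value problem does not vanish identically. -/
theorem not_eqOn_zero (hβ : IsSmoothBoundaryParam Ω β L) (hopen : IsOpen Ω)
    {g : ℂ → ℂ} {u : ℂ} (hg : IsBoundaryPoleSolution Ω β u g) : ¬ ∀ z ∈ Ω, g z = 0 := by
  intro h0
  obtain ⟨t, σ, rfl, hσ, hO⟩ := hg.pole
  have := hβ.neBot_nhdsWithin t
  have h1 := hβ.tendsto_mul_sub_of_pole hopen hO
  have h2 : Tendsto (fun z => g z * (z - β t)) (𝓝[Ω] (β t)) (𝓝 0) := by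
    refine tendsto_const_nhds.congr' ?_
    filter_upwards [self_mem_nhdsWithin] with z hz
    rw [h0 z hz, zero_mul]
  have h3 := tendsto_nhds_unique h1 h2
  have hσ0 : σ = 0 := by
    have : (Real.pi : ℂ) ≠ 0 := by exact_mod_cast Real.pi_ne_zero
    simpa [this] using h3
  rw [hσ0, outerNormal] at hσ
  have h4 : deriv β t = 0 := by simpa using hσ.symm
  have h5 := hβ.unit_speed t
  rw [h4] at h5
  simp at h5

/-- The local boundary constants agree on overlaps by uniqueness of limits, and the parameter
interval is connected. -/
theorem exists_tendsto_re_of_Ioo (hβ : IsSmoothBoundaryParam Ω β L) (hopen : IsOpen Ω)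
    {F h : ℂ → ℂ} {S : Set ℂ} (hF : ∀ z ∈ Ω, HasDerivAt F (h z) z) (hS : IsClosed S)
    (hh : ContinuousOn h (closure Ω \ S))
    (hbd : ∀ t, β t ∉ S → (h (β t) * deriv β t).re = 0) {a b : ℝ} (hab : a < b)
    (hSab : ∀ t ∈ Ioo a b, β t ∉ S) :
    ∃ K : ℝ, ∀ t ∈ Ioo a b, Tendsto (fun z => (F z).re) (𝓝[Ω] (β t)) (𝓝 K) := by
  have hloc : ∀ t ∈ Ioo a b, ∃ K : ℝ, ∀ᶠ s in 𝓝 t,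
      Tendsto (fun z => (F z).re) (𝓝[Ω] (β s)) (𝓝 K) := fun t ht =>
    hβ.exists_eventually_tendsto_re hopen hF hS hh hbd (hSab t ht)
  obtain ⟨t₁, ht₁⟩ := nonempty_Ioo.2 hab
  obtain ⟨K, hK⟩ := hloc t₁ ht₁
  refine ⟨K, ?_⟩
  suffices Ioo a b ⊆ {t | ∀ᶠ s in 𝓝 t, Tendsto (fun z => (F z).re) (𝓝[Ω] (β s)) (𝓝 K)} from
    fun t ht => (this ht).self_of_nhds
  refine isPreconnected_Ioo.subset_of_closure_inter_subset
    (isOpen_iff_mem_nhds.2 fun t ht => eventually_eventually_nhds.2 ht) ⟨t₁, ht₁, hK⟩ ?_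
  rintro t ⟨ht, htab⟩
  obtain ⟨K', hK'⟩ := hloc t htab
  obtain ⟨s, hs, hs'⟩ := ((mem_closure_iff_frequently.1 ht).and_eventually hK').exists
  have := hβ.neBot_nhdsWithin s
  obtain rfl := tendsto_nhds_unique hs.self_of_nhds hs'
  exact hK'

/-- The two arcs into which two boundary points divide the boundary. -/
theorem mem_arc_cases (hβ : IsSmoothBoundaryParam Ω β L) (a b : ℝ)
    {ζ : ℂ} (hζ : ζ ∈ frontier Ω) :
    ζ = β a ∨ ζ = β b ∨ (∃ t ∈ Ioo a b, β t = ζ) ∨ ∃ t ∈ Ioo b (a + L), β t = ζ := by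
  rw [← hβ.range_eq] at hζ
  obtain ⟨s, rfl⟩ := hζ
  obtain ⟨t, ht, hts⟩ := hβ.exists_mem_Ico_eq a s
  rcases ht.1.eq_or_lt with h | h
  · left; rw [h, hts]
  rcases lt_trichotomy t b with h' | h' | h'
  · exact Or.inr (Or.inr (Or.inl ⟨t, ⟨h, h'⟩, hts⟩))
  · right; left; rw [← h', hts]
  · exact Or.inr (Or.inr (Or.inr ⟨t, ⟨h', ht.2⟩, hts⟩))

theorem ne_of_lt_of_lt_add (hβ : IsSmoothBoundaryParam Ω β L) {s t : ℝ} (h1 : s < t)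
    (h2 : t < s + L) : β s ≠ β t := by
  intro h
  obtain ⟨k, rfl⟩ := hβ.eq_add_of_eq h
  have hL := hβ.length_pos
  have hk1 : (-1 : ℝ) < k := by nlinarith
  have hk2 : (k : ℝ) < 0 := by nlinarith
  have hk1' : -1 < k := by exact_mod_cast hk1
  have hk2' : k < 0 := by exact_mod_cast hk2
  omega

theorem boundaryArc_eq (hβ : IsSmoothBoundaryParam Ω β L) {a b : ℝ} (hab : a < b)
    (hba : b < a + L) : boundaryArc β L (β a) (β b) = β '' Ioo a b := by
  ext z
  constructor
  · rintro ⟨a', b', ha', hb', hab', hba', t, ht, rfl⟩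
    obtain ⟨k, rfl⟩ := hβ.eq_add_of_eq ha'
    obtain ⟨m, rfl⟩ := hβ.eq_add_of_eq hb'
    have hmk : m = k := by
      have hL := hβ.length_pos
      have h1 : (m : ℝ) - k < 1 := by nlinarith
      have h2 : (-1 : ℝ) < m - k := by nlinarith
      have h1' : m - k < 1 := by exact_mod_cast h1
      have h2' : -1 < m - k := by exact_mod_cast h2
      omega
    subst hmk
    refine ⟨t + ((-m : ℤ) : ℝ) * L, ?_, hβ.add_int_mul t (-m)⟩
    push_cast
    exact ⟨by linarith [ht.1], by linarith [ht.2]⟩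
  · rintro ⟨t, ht, rfl⟩
    exact ⟨a, b, rfl, rfl, hab, hba, t, ht, rfl⟩

end IsSmoothBoundaryParam

theorem tendsto_log_norm_sub_atBot {p : ℂ} (hp : p ∉ Ω) :
    Tendsto (fun z => Real.log ‖z - p‖) (𝓝[Ω] p) atBot := by
  refine Real.tendsto_log_nhdsGT_zero.comp (tendsto_nhdsWithin_iff.2 ⟨?_, ?_⟩)
  · have : Continuous fun z : ℂ => ‖z - p‖ := by fun_prop
    have h := this.tendsto p
    simp only [sub_self, norm_zero] at h
    exact h.mono_left nhdsWithin_le_nhds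
  · filter_upwards [self_mem_nhdsWithin] with z hz
    exact norm_pos_iff.2 (sub_ne_zero.2 fun h => hp (h ▸ hz))

theorem tendsto_mul_add_atTop_of_abs_le_sub_log {p : ℂ} (hp : p ∉ Ω) {b U : ℂ → ℝ}
    (hb : ∀ z ∈ Ω, -Real.log ‖z - p‖ ≤ b z)
    (hU : ∀ η : ℝ, 0 < η → ∃ C : ℝ, ∀ᶠ z in 𝓝[Ω] p, |U z| ≤ C - η * Real.log ‖z - p‖)
    {ε : ℝ} (hε : 0 < ε) : Tendsto (fun z => ε * b z + U z) (𝓝[Ω] p) atTop := by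
  obtain ⟨C, hC⟩ := hU (ε / 2) (half_pos hε)
  have h1 : Tendsto (fun z => -(ε / 2) * Real.log ‖z - p‖ + -C) (𝓝[Ω] p) atTop :=
    tendsto_atTop_add_const_right _ _
      ((tendsto_log_norm_sub_atBot hp).const_mul_atBot_of_neg (by linarith))
  refine tendsto_atTop_mono' _ ?_ h1
  filter_upwards [hC, self_mem_nhdsWithin] with z hz hzΩ
  have h2 := mul_le_mul_of_nonneg_left (hb z hzΩ) hε.le
  have h3 := (abs_le.1 hz).1
  linarith

/-- A positive harmonic function with logarithmic poles at two given boundary points. -/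
theorem exists_log_barrier (hbdd : Bornology.IsBounded Ω) {u v : ℂ} (hu : u ∉ Ω) (hv : v ∉ Ω) :
    ∃ b : ℂ → ℝ, InnerProductSpace.HarmonicOnNhd b Ω ∧ (∀ z ∈ Ω, 0 ≤ b z) ∧
      (∀ z ∈ Ω, -Real.log ‖z - u‖ ≤ b z) ∧ ∀ z ∈ Ω, -Real.log ‖z - v‖ ≤ b z := by
  obtain ⟨R, hR⟩ := hbdd.exists_norm_le
  -- `D` bounds both distances, so `log D - log ‖z - p‖` is nonnegative. With `D ≥ 1` the leftover
  -- terms are nonnegative too, so the barrier dominates each logarithm separately.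
  set D : ℝ := max 1 (R + ‖u‖ + ‖v‖) with hD
  have hD1 : 1 ≤ D := le_max_left _ _
  have hle : ∀ z ∈ Ω, ‖z - u‖ ≤ D ∧ ‖z - v‖ ≤ D := by
    intro z hz
    have h1 := norm_sub_le z u
    have h2 := norm_sub_le z v
    have h3 := hR z hz
    have h4 := norm_nonneg u
    have h5 := norm_nonneg v
    have h6 : R + ‖u‖ + ‖v‖ ≤ D := le_max_right _ _
    constructor <;> linarith
  have hlog0 : 0 ≤ Real.log D := Real.log_nonneg hD1
  have hpos : ∀ p ∉ Ω, ∀ z ∈ Ω, z - p ≠ 0 := fun p hp z hz =>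
    sub_ne_zero.2 fun h => hp (h ▸ hz)
  have hlog : ∀ z ∈ Ω, Real.log ‖z - u‖ ≤ Real.log D ∧ Real.log ‖z - v‖ ≤ Real.log D :=
    fun z hz => ⟨Real.log_le_log (norm_pos_iff.2 (hpos u hu z hz)) (hle z hz).1,
      Real.log_le_log (norm_pos_iff.2 (hpos v hv z hz)) (hle z hz).2⟩
  have hharm : ∀ p ∉ Ω, InnerProductSpace.HarmonicOnNhd (fun z => Real.log ‖z - p‖) Ω :=
    fun p hp z hz => AnalyticAt.harmonicAt_log_norm (by fun_prop) (hpos p hp z hz)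
  refine ⟨fun z => 2 * Real.log D - Real.log ‖z - u‖ - Real.log ‖z - v‖,
    ((InnerProductSpace.harmonicOnNhd_const _).sub (hharm u hu)).sub (hharm v hv), ?_, ?_, ?_⟩ <;>
  · intro z hz
    have := hlog z hz
    linarith [this.1, this.2]

theorem eq_zero_of_hasDerivAt_of_re_eq_const (hopen : IsOpen Ω) {F h : ℂ → ℂ}
    (hF : ∀ z ∈ Ω, HasDerivAt F (h z) z) {K : ℝ} (hK : ∀ z ∈ Ω, (F z).re = K) :
    ∀ z ∈ Ω, h z = 0 := by
  intro z hz
  have key : ∀ v : ℂ, (h z * v).re = 0 := by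
    intro v
    have hφ : HasDerivAt (fun t : ℝ => z + (t : ℂ) * v) v 0 := by
      have h1 : HasDerivAt (fun e : ℝ => (e : ℂ)) 1 0 := Complex.ofRealCLM.hasDerivAt
      have h2 := (h1.mul_const v).const_add z
      rwa [one_mul] at h2
    have h1 := hasDerivAt_re_comp (F := F) (h := h z) (φ := fun t : ℝ => z + (t : ℂ) * v) (t := 0)
      (by simpa using hF z hz) hφ
    refine h1.unique ((hasDerivAt_const (0 : ℝ) K).congr_of_eventuallyEq ?_)
    have : ∀ᶠ t : ℝ in 𝓝 0, z + (t : ℂ) * v ∈ Ω :=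
      hφ.continuousAt.eventually (by simpa using hopen.mem_nhds hz)
    filter_upwards [this] with t ht
    exact hK _ ht
  have h1 := key 1
  have h2 := key Complex.I
  rw [mul_one] at h1
  apply Complex.ext
  · exact h1
  · simpa using h2

/-- If `h` has a primitive `F` in `Ω` and `Re [h(z) dz]` vanishes along the boundary, off two
points at which `h` has at most simple poles with imaginary residue, then `Re F` is an affine
function of the harmonic measure. -/
theorem exists_re_eq_add_mul_harmonicMeasure (hopen : IsOpen Ω) (hbdd : Bornology.IsBounded Ω)
    (hβ : IsSmoothBoundaryParam Ω β L) {a b : ℝ} (hab : a < b) (hba : b < a + L) {F h : ℂ → ℂ}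
    (hF : ∀ z ∈ Ω, HasDerivAt F (h z) z) (hh : ContinuousOn h (closure Ω \ {β a, β b}))
    (hbd : ∀ t, β t ∉ ({β a, β b} : Set ℂ) → (h (β t) * deriv β t).re = 0)
    (hsing : ∀ p ∈ ({β a, β b} : Set ℂ), ∃ (t : ℝ) (A : ℂ), β t = p ∧ A.re = 0 ∧
      Tendsto (fun z => h z * (z - β t)) (𝓝[Ω] (β t)) (𝓝 A)) (hne : ¬ ∀ z ∈ Ω, h z = 0) :
    ∃ c K : ℝ, c ≠ 0 ∧
      (∀ z ∈ β '' Ioo a b, Tendsto (fun z => (F z).re) (𝓝[Ω] z) (𝓝 K)) ∧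
      ∀ w ∈ Ω, (F w).re - K = c * harmonicMeasure Ω (boundaryArc β L (β b) (β a)) w := by
  have hL := hβ.length_pos
  have hS : IsClosed ({β a, β b} : Set ℂ) := (toFinite _).isClosed
  have haL : β (a + L) = β a := hβ.periodic a
  have hS1 : ∀ t ∈ Ioo a b, β t ∉ ({β a, β b} : Set ℂ) := by
    rintro t ht (h | h)
    · exact hβ.ne_of_lt_of_lt_add ht.1 (by linarith [ht.2]) h.symm
    · exact hβ.ne_of_lt_of_lt_add ht.2 (by linarith [ht.1]) h
  have hS2 : ∀ t ∈ Ioo b (a + L), β t ∉ ({β a, β b} : Set ℂ) := by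
    rintro t ht (h | h)
    · exact hβ.ne_of_lt_of_lt_add (show a < t by linarith [ht.1]) ht.2 h.symm
    · exact hβ.ne_of_lt_of_lt_add ht.1 (by linarith [ht.2]) (mem_singleton_iff.1 h).symm
  obtain ⟨K₁, hK₁⟩ := hβ.exists_tendsto_re_of_Ioo hopen hF hS hh hbd hab hS1
  obtain ⟨K₂, hK₂⟩ := hβ.exists_tendsto_re_of_Ioo hopen hF hS hh hbd hba hS2
  have harc : boundaryArc β L (β b) (β a) = β '' Ioo b (a + L) := by
    rw [← haL]
    exact hβ.boundaryArc_eq hba (by linarith)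
  obtain ⟨B, hBharm, hB0, hBa, hBb⟩ := exists_log_barrier hbdd (hβ.notMem hopen a)
    (hβ.notMem hopen b)
  have hBS : ∀ p ∈ ({β a, β b} : Set ℂ), ∀ z ∈ Ω, -Real.log ‖z - p‖ ≤ B z := by
    rintro p (rfl | rfl)
    · exact hBa
    · exact hBb
  have hgrow : ∀ p ∈ ({β a, β b} : Set ℂ), ∀ k : ℝ, ∀ η : ℝ, 0 < η →
      ∃ C : ℝ, ∀ᶠ z in 𝓝[Ω] p, |k * ((F z).re - K₁)| ≤ C - η * Real.log ‖z - p‖ := by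
    intro p hp k η hη
    obtain ⟨t, A, rfl, hA, hlim⟩ := hsing p hp
    -- `|k| + 1` in place of `|k|` permits division also for `k = 0`.
    have hk : 0 < |k| + 1 := by positivity
    obtain ⟨C, hC⟩ := hβ.eventually_abs_re_le_sub_log hopen hF hA hlim
      (show 0 < η / (|k| + 1) by positivity)
    refine ⟨(|k| + 1) * (C + |K₁|), ?_⟩
    filter_upwards [hC] with z hz
    rw [abs_mul]
    have h1 : |(F z).re - K₁| ≤ C - η / (|k| + 1) * Real.log ‖z - β t‖ + |K₁| :=
      (abs_sub _ _).trans (by linarith)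
    calc |k| * |(F z).re - K₁| ≤ (|k| + 1) * |(F z).re - K₁| :=
          mul_le_mul_of_nonneg_right (by linarith) (abs_nonneg _)
      _ ≤ (|k| + 1) * (C - η / (|k| + 1) * Real.log ‖z - β t‖ + |K₁|) :=
          mul_le_mul_of_nonneg_left h1 hk.le
      _ = (|k| + 1) * (C + |K₁|) - η * Real.log ‖z - β t‖ := by field_simp; ring
  have hsing' : ∀ k : ℝ, ∀ p ∈ ({β a, β b} : Set ℂ), ∀ ε : ℝ, 0 < ε →
      Tendsto (fun z => ε * B z - k * ((F z).re - K₁)) (𝓝[Ω] p) atTop ∧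
      Tendsto (fun z => ε * B z + k * ((F z).re - K₁)) (𝓝[Ω] p) atTop := by
    intro k p hp ε hε
    have hpΩ : p ∉ Ω := by
      obtain ⟨t, -, rfl, -⟩ := hsing p hp
      exact hβ.notMem hopen t
    refine ⟨?_, tendsto_mul_add_atTop_of_abs_le_sub_log hpΩ (hBS p hp) (hgrow p hp k) hε⟩
    refine (tendsto_mul_add_atTop_of_abs_le_sub_log hpΩ (hBS p hp) (hgrow p hp (-k)) hε).congr
      fun z => by ring
  have hharm : ∀ k : ℝ, InnerProductSpace.HarmonicOnNhd (fun z => k * ((F z).re - K₁)) Ω := by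
    intro k
    have hFd : DifferentiableOn ℂ F Ω := fun z hz => (hF z hz).differentiableAt.differentiableWithinAt
    have h1 : InnerProductSpace.HarmonicOnNhd (fun z => (F z).re) Ω := fun z hz =>
      (hFd.analyticAt (hopen.mem_nhds hz)).harmonicAt_re
    exact (h1.sub (InnerProductSpace.harmonicOnNhd_const K₁)).const_smul (c := k)
  -- Stated for all `k` and `A` to be used twice: for the arc, and for the empty set to rule out `K₂
  -- = K₁`. In that case both `k = 1` and `k = 0` represent the harmonic measure of `∅`, which
  -- forces `Re F` to be constant.
  have hmain : ∀ (k : ℝ) (A : Set ℂ), (∀ t ∈ Ioo a b, β t ∉ A) →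
      (∀ t ∈ Ioo b (a + L), k * (K₂ - K₁) = A.indicator (fun _ => (1 : ℝ)) (β t)) →
      ∀ w ∈ Ω, harmonicMeasure Ω A w = k * ((F w).re - K₁) := by
    intro k A hA1 hA2 w hw
    refine harmonicMeasure_eq_of_barrier (P := {β a, β b}) hopen hbdd (hharm k) hBharm hB0 ?_
      (hsing' k) hw
    intro ζ hζ hζS
    rcases hβ.mem_arc_cases a b hζ with rfl | rfl | ⟨t, ht, rfl⟩ | ⟨t, ht, rfl⟩
    · exact absurd (mem_insert _ _) hζS
    · exact absurd (mem_insert_of_mem _ rfl) hζS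
    · rw [indicator_of_notMem (hA1 t ht)]
      simpa using ((hK₁ t ht).sub_const K₁).const_mul k
    · rw [← hA2 t ht]
      exact ((hK₂ t ht).sub_const K₁).const_mul k
  have hc : K₂ - K₁ ≠ 0 := by
    intro hc
    refine hne (eq_zero_of_hasDerivAt_of_re_eq_const hopen hF (K := K₁) fun w hw => ?_)
    have h1 := hmain 1 ∅ (fun _ _ => notMem_empty _) (fun t _ => by simp [hc]) w hw
    have h2 := hmain 0 ∅ (fun _ _ => notMem_empty _) (fun t _ => by simp) w hw
    rw [h1] at h2
    linarith
  refine ⟨K₂ - K₁, K₁, hc, ?_, fun w hw => ?_⟩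
  · rintro _ ⟨t, ht, rfl⟩
    exact hK₁ t ht
  · rw [harc, hmain (K₂ - K₁)⁻¹ (β '' Ioo b (a + L)) ?_ ?_ w hw]
    · field_simp
    · rintro t ht ⟨s, hs, hst⟩
      exact hβ.ne_of_lt_of_lt_add (ht.2.trans hs.1) (by linarith [ht.1, hs.2]) hst.symm
    · intro t ht
      rw [indicator_of_mem (mem_image_of_mem β ht), inv_mul_cancel₀ hc]

end Hedgehog

/-! ### The main theorem -/

theorem mainTheorem11 (Ω : Set ℂ) (hopen : IsOpen Ω) (hbdd : Bornology.IsBounded Ω)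
    (hsc : IsSimplyConnected Ω) (β : ℝ → ℂ) (L : ℝ)
    (hβ : Hedgehog.IsSmoothBoundaryParam Ω β L) (u₀ v₀ : ℂ)
    (hu₀ : Hedgehog.OnStraightPart Ω u₀) (hv₀ : Hedgehog.OnStraightPart Ω v₀)
    (h0 : (0 : ℂ) ∈ Hedgehog.boundaryArc β L u₀ v₀) (f g : ℂ → ℂ)
    (hf : Hedgehog.IsBoundaryPoleSolution Ω β v₀ f)
    (hg : Hedgehog.IsBoundaryPoleSolution Ω β u₀ g) :
    ∃ c : ℝ, c ≠ 0 ∧ ∀ w ∈ Ω,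
      (∃ γ : Path (0 : ℂ) w, Hedgehog.IsPathInto Ω γ) ∧
      ∀ γ : Path (0 : ℂ) w, Hedgehog.IsPathInto Ω γ →
        CurveIntegrable (Hedgehog.reForm (fun z => f z * g z)) γ ∧
        curveIntegral (Hedgehog.reForm (fun z => f z * g z)) γ =
          c * Hedgehog.harmonicMeasure Ω (Hedgehog.boundaryArc β L v₀ u₀) w := by
  obtain ⟨a, b, rfl, rfl, hab, hba, h0ab⟩ := h0
  have huv : β a ≠ β b := hβ.ne_of_lt_of_lt_add hab hba
  have hconn : IsPreconnected Ω := hsc.isPathConnected.isConnected.isPreconnected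
  obtain ⟨F, hF⟩ := Hedgehog.exists_primitive hopen hsc
    (hf.differentiableOn.mul hg.differentiableOn)
  replace hF : ∀ z ∈ Ω, HasDerivAt F (f z * g z) z := hF
  have hh : ContinuousOn (fun z => f z * g z) (closure Ω \ {β a, β b}) :=
    (hf.continuousOn.mono fun z hz => ⟨hz.1, fun h => hz.2 (Or.inr h)⟩).mul
      (hg.continuousOn.mono fun z hz => ⟨hz.1, fun h => hz.2 (Or.inl h)⟩)
  have hne : ¬ ∀ z ∈ Ω, f z * g z = 0 := by
    intro hz
    rcases AnalyticOnNhd.eq_zero_or_eq_zero_of_mul_eq_zero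
      (hf.differentiableOn.analyticOnNhd hopen) (hg.differentiableOn.analyticOnNhd hopen) hz hconn
      with h | h
    · exact hβ.not_eqOn_zero hopen hf h
    · exact hβ.not_eqOn_zero hopen hg h
  obtain ⟨c, K, hc, hlim, hhm⟩ := Hedgehog.exists_re_eq_add_mul_harmonicMeasure hopen hbdd hβ hab
    hba hF hh
    (fun t ht => hf.re_mul_mul_deriv_eq_zero hg (fun h => ht (Or.inl h)) (fun h => ht (Or.inr h)))
    (by
      rintro p (rfl | rfl)
      · exact hβ.exists_tendsto_mul_mul_sub hopen hf hg huv
      · obtain ⟨t, A, h1, h2, h3⟩ := hβ.exists_tendsto_mul_mul_sub hopen hg hf huv.symm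
        exact ⟨t, A, h1, h2, h3.congr fun z => by ring⟩) hne
  obtain ⟨t, ht, ht0⟩ := h0ab
  refine ⟨c, hc, fun w hw => ⟨?_, fun γ hγ => ?_⟩⟩
  -- A short segment along the inner normal at 0 enters `Ω`, and connectedness extends it to `w`.
  · obtain ⟨ε₀, hε₀, hε⟩ := (nhdsGT_basis (0 : ℝ)).eventually_iff.1 (hβ.left_mem t)
    have hε₀' : 0 < ε₀ / 2 := half_pos hε₀
    refine (Hedgehog.isPathInto_segment (Ω := Ω) (a := 0)
      (b := ((ε₀ / 2 : ℝ) : ℂ) * (Complex.I * deriv β t)) fun s hs0 hs1 => ?_).exists_of_isPreconnected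
        hopen hconn hw
    have := hε (x := s * (ε₀ / 2)) ⟨by positivity, by nlinarith⟩
    rw [ht0, zero_add] at this
    rw [AffineMap.lineMap_apply]
    convert this using 1
    simp [mul_assoc]
  · rw [← hhm w hw]
    refine hγ.curveIntegral_reForm hF (hh.mono ?_) (hlim 0 ⟨t, ht, ht0⟩)
    have hmem : ∀ z ∈ Ω, z ∉ ({β a, β b} : Set ℂ) := by
      rintro z hz (rfl | rfl)
      · exact hβ.notMem hopen a hz
      · exact hβ.notMem hopen b hz
    rintro z (rfl | hz)
    · rw [← ht0]
      refine ⟨(hβ.mem_frontier t).1, ?_⟩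
      rintro (h | h)
      · exact hβ.ne_of_lt_of_lt_add ht.1 (by linarith [ht.2]) h.symm
      · exact hβ.ne_of_lt_of_lt_add ht.2 (by linarith [ht.1]) h
    · exact ⟨subset_closure hz, hmem z hz⟩
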